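/- Let $1\le q\le p$ be integers. Write $M(p,q)$ for the real $p\times q$ matrices, $P^+(q)$ for the symmetric positive definite $q\times q$ matrices, and $A^{1/2}\in P^+(q)$ for the positive definite square root of $A\in P^+(q)$. For $A,B\in P^+(q)$ put $A\circ B=B^{1/2}AB^{1/2}$. Let $\mu(\mathrm dS)=(\det S)^{-(q+1)/2}\prod_{i\le j}\mathrm dS_{ij}$ on $P^+(q)$, and let $\Gamma_q(a)=\int_{P^+(q)}e^{-\operatorname{tr}S}(\det S)^{a}\,\mu(\mathrm dS)$, $a>(q-1)/2$, be the multivariate Gamma function. Let $\mathcal O(p,q)$ be the set of $\mathsf U\in M(p,q)$ with $\mathsf U^\top\mathsf U=I_q$, and let $\mathrm d\mathsf U$ be the uniform probability measure on it, i.e. the law of the first $q$ columns of a Haar-distributed orthogonal $p\times p$ matrix. For $\Sigma\in P^+(p)$ and $T\in P^+(q)$, $N_{p,q}(0,\Sigma,T)$ is the matrix-normal law with Lebesgue density $$\frac{\exp(-\tfrac12\operatorname{tr}[T^{-1}X^\top\Sigma^{-1}X])}{(2\pi)^{pq/2}(\det\Sigma)^{q/2}(\det T)^{p/2}}\quad\text{on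 } M(p,q),$$ and $W_q^{-1}(r,T)$, $r>q-1$, is the inverse Wishart law on $P^+(q)$ with density $$\frac{(\det T)^{r/2}\exp(-\tfrac12\operatorname{tr}[TS^{-1}])}{2^{rq/2}(\det S)^{r/2}\,\Gamma_q(r/2)}$$ with respect to $\mu$. For $\rho\in[0,1)$, $U\in P^+(p)$ and $x\in M(p,q)$ with $\det(x^\top U^{-1}x)\ne0$, the MpCN proposal $Q(x,\cdot)=Q(x,\cdot\,;\rho,U)$ is the law of $y=\rho^{1/2}x+(1-\rho)^{1/2}w$, where $V\sim W_q^{-1}(p,x^\top U^{-1}x)$ and, given $V$, $w\sim N_{p,q}(0,U,V)$. Let $\rho\in[0,1)$ and define the measure on $P^+(q)$ $$\mathcal L(\mathrm d\epsilon)=(1-\rho)^{pq/2}\,\frac{\Gamma_q(p)}{\Gamma_q(p/2)^2}\;\mu(\mathrm d\epsilon)\int_{\mathcal O(p,q)}\frac{\det(\epsilon)^{p/2}}{\det\bigl(I_q+\epsilon-\rho^{1/2}(\mathsf U_1\epsilon^{1/2}+\epsilon^{1/2}\mathsf U_1^\top)\bigr)^{p}}\,\mathrm d\mathsf U,$$ where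 $\mathsf U_1$ denotes the first $q$ rows of $\mathsf U$. Thus $\mathcal L$ depends only on $p,q,\rho$. Then $\mathcal L$ is a probability measure, $\mathcal L$ is invariant under $\epsilon\mapsto\epsilon^{-1}$, and for every $U\in P^+(p)$ and every $x\in M(p,q)$ with $\det(x^\top U^{-1}x)\ne0$ the following holds: $Q(x,\cdot)$ is a probability measure and, for every random matrix $y\sim Q(x,\cdot)$, there is a $P^+(q)$-valued random variable $\epsilon$ on the same probability space such that (i) $y^\top U^{-1}y=\epsilon\circ(x^\top U^{-1}x)$ almost surely; (ii) $\epsilon$ has law $\mathcal L$ (in particular its law does not depend on $x$ or $U$); (iii) $\epsilon$ and $\epsilon^{-1}$ have the same law. -/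

import Mathlib

open MeasureTheory ProbabilityTheory Matrix
open scoped ENNReal

namespace MpCN

noncomputable section

/-! ### Matrices as a measure space -/

/-- The Borel structure on matrices, entry by entry. -/
instance matrixMeasurableSpace (m n : Type*) : MeasurableSpace (Matrix m n ℝ) :=
  inferInstanceAs (MeasurableSpace (m → n → ℝ))

instance matrixBorelSpace (m n : Type*) [Countable m] [Countable n] :
    BorelSpace (Matrix m n ℝ) :=
  inferInstanceAs (BorelSpace (m → n → ℝ))

/-- The Lebesgue measure `∏ dX_ij` on the space `M(p,q)` of real `p × q` matrices. -/
def lebM (p q : ℕ) : Measure (Matrix (Fin p) (Fin q) ℝ) :=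
  (volume : Measure (Fin p → Fin q → ℝ))

/-! ### Positive definite matrices -/

open scoped MatrixOrder in
/-- The positive square root `A^{1/2}` of a positive semidefinite matrix. -/
def psqrt {q : ℕ} (A : Matrix (Fin q) (Fin q) ℝ) : Matrix (Fin q) (Fin q) ℝ :=
  CFC.sqrt A

/-- The operation `A ∘ B = B^{1/2} A B^{1/2}`. -/
def circ {q : ℕ} (A B : Matrix (Fin q) (Fin q) ℝ) : Matrix (Fin q) (Fin q) ℝ :=
  psqrt B * A * psqrt B

/-- The symmetric matrix with given entries on and above the diagonal. -/
def symOfUpper {q : ℕ} (v : {ij : Fin q × Fin q // ij.1 ≤ ij.2} → ℝ) :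
    Matrix (Fin q) (Fin q) ℝ :=
  Matrix.of fun i j => v ⟨(min i j, max i j), min_le_max⟩

/-- The measure `μ(dS) = (det S)^{-(q+1)/2} ∏_{i ≤ j} dS_ij` on the positive definite matrices,
as a measure on all `q × q` matrices that is carried by the positive definite ones. -/
def muP (q : ℕ) : Measure (Matrix (Fin q) (Fin q) ℝ) :=
  (((volume : Measure ({ij : Fin q × Fin q // ij.1 ≤ ij.2} → ℝ)).map symOfUpper).restrict
    {S | S.PosDef}).withDensity fun S => ENNReal.ofReal (S.det ^ (-((q : ℝ) + 1) / 2))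

/-- The multivariate Gamma function
`Γ_q(a) = ∫_{S > 0} exp(-tr S) (det S)^{a - (q+1)/2} ∏_{i ≤ j} dS_ij`, for `a > (q-1)/2`. -/
def multiGamma (q : ℕ) (a : ℝ) : ℝ :=
  ∫ S, Real.exp (-S.trace) * S.det ^ a ∂(muP q)

/-! ### The uniform distribution on matrices with orthonormal columns -/

/-- The orthogonal group (the unitary group over `ℝ`, where `star` is the transpose) is compact. -/
instance orthogonalCompactSpace (p : ℕ) : CompactSpace (Matrix.unitaryGroup (Fin p) ℝ) := by
  have hK : IsCompact {A : Matrix (Fin p) (Fin p) ℝ | ∀ i, A i ∈ {v : Fin p → ℝ |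
      ∀ j, v j ∈ Set.Icc (-1 : ℝ) 1}} :=
    isCompact_pi_infinite fun _ => isCompact_pi_infinite fun _ => isCompact_Icc
  refine isCompact_iff_compactSpace.mp (hK.of_isClosed_subset ?_ ?_)
  · have h : ((Matrix.unitaryGroup (Fin p) ℝ : Submonoid (Matrix (Fin p) (Fin p) ℝ)) :
        Set (Matrix (Fin p) (Fin p) ℝ)) = {A | A * star A = 1} := by
      ext A
      exact Matrix.mem_unitaryGroup_iff
    rw [h]
    exact isClosed_eq (by fun_prop) continuous_const
  · intro A hA i j
    exact abs_le.mp (entry_norm_bound_of_unitary hA i j)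

/-- The uniform distribution on the orthogonal group: its normalised Haar measure. -/
def uniformO (p : ℕ) : Measure (Matrix.unitaryGroup (Fin p) ℝ) :=
  Measure.haarMeasure ⊤

/-- The uniform distribution on the set `O(p,q)` of `p × q` matrices with orthonormal columns:
the law of the first `q` columns of a uniform orthogonal `p × p` matrix. -/
def uniformStiefel {p q : ℕ} (hqp : q ≤ p) : Measure (Matrix (Fin p) (Fin q) ℝ) :=
  (uniformO p).map fun O => O.1.submatrix id (Fin.castLE hqp)

/-! ### Matrix-normal and inverse Wishart distributions, and the MpCN proposal -/

/-- The matrix-normal distribution `N_{p,q}(M, Σ, T)`. -/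
def matrixNormal {p q : ℕ} (M : Matrix (Fin p) (Fin q) ℝ) (Sig : Matrix (Fin p) (Fin p) ℝ)
    (T : Matrix (Fin q) (Fin q) ℝ) : Measure (Matrix (Fin p) (Fin q) ℝ) :=
  (lebM p q).withDensity fun X => ENNReal.ofReal
    (Real.exp (-(T⁻¹ * (X - M)ᵀ * Sig⁻¹ * (X - M)).trace / 2) /
      ((2 * Real.pi) ^ ((p : ℝ) * q / 2) * Sig.det ^ ((q : ℝ) / 2) * T.det ^ ((p : ℝ) / 2)))

/-- The inverse Wishart distribution `W_q^{-1}(r, T)`. -/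
def inverseWishart {q : ℕ} (r : ℝ) (T : Matrix (Fin q) (Fin q) ℝ) :
    Measure (Matrix (Fin q) (Fin q) ℝ) :=
  (muP q).withDensity fun S => ENNReal.ofReal
    (T.det ^ (r / 2) * Real.exp (-(T * S⁻¹).trace / 2) /
      ((2 : ℝ) ^ (r * q / 2) * S.det ^ (r / 2) * multiGamma q (r / 2)))

/-- The MpCN proposal `Q(x, ·)` with parameters `ρ`, `U`: the law of
`y = ρ^{1/2} x + (1-ρ)^{1/2} w`, where `V ∼ W_q^{-1}(p, xᵀ U⁻¹ x)` and, given `V`,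
`w ∼ N_{p,q}(0, U, V)`. -/
def proposal {p q : ℕ} (ρ : ℝ) (U : Matrix (Fin p) (Fin p) ℝ) (x : Matrix (Fin p) (Fin q) ℝ) :
    Measure (Matrix (Fin p) (Fin q) ℝ) :=
  ((inverseWishart (p : ℝ) (xᵀ * U⁻¹ * x)).bind fun V => matrixNormal 0 U V).map
    fun w => √ρ • x + √(1 - ρ) • w

/-! ### The law of the multiplicative noise -/

/-- `c_{p,q} = Γ_q(p) / Γ_q(p/2)²`. -/
def constC (p q : ℕ) : ℝ :=
  multiGamma q p / multiGamma q ((p : ℝ) / 2) ^ 2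

/-- The law
`(1-ρ)^{pq/2} c_{p,q} μ(dε) ∫ det(ε)^{p/2} / det(I + ε - ρ^{1/2}(U₁ ε^{1/2} + ε^{1/2} U₁ᵀ))^p dU`,
with the integral over the uniform distribution on `O(p,q)`, and `U₁` the first `q` rows
of `U`. -/
def noiseLaw {p q : ℕ} (hqp : q ≤ p) (ρ : ℝ) : Measure (Matrix (Fin q) (Fin q) ℝ) :=
  (muP q).withDensity fun ε =>
    ENNReal.ofReal ((1 - ρ) ^ ((p : ℝ) * q / 2) * constC p q) *
      ∫⁻ O, ENNReal.ofReal
        (let O₁ : Matrix (Fin q) (Fin q) ℝ := O.submatrix (Fin.castLE hqp) id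
         ε.det ^ ((p : ℝ) / 2) /
          (1 + ε - √ρ • (O₁ * psqrt ε + psqrt ε * O₁ᵀ)).det ^ p) ∂(uniformStiefel hqp)

end

end MpCN

namespace MpCN

/-! ### Determinants of linear actions on matrices -/

/-! Put `S = xᵀ U⁻¹ x` and let `E` be the first `q` columns of the identity. Integrating out `V`
gives `w` a density proportional to `det (S + wᵀ U⁻¹ w) ^ (-p)`. Since `U^{-1/2} x S^{-1/2}` has
orthonormal columns, `x = B E S^{1/2}` for some `B` with `Bᵀ U⁻¹ B = 1`. In the coordinate `z` given
by `y = B z S^{1/2}`, the proposal has density proportional to `det (1 + zᵀ z - √ρ (Eᵀ z + zᵀ E)) ^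
(-p)`, free of `x` and `U` (`lintegral_proposal`), while `S^{-1/2} (yᵀ U⁻¹ y) S^{-1/2} = zᵀ z`. The
polar decomposition `z = O ε^{1/2}` of Lebesgue measure (`lintegral_polar`) then identifies the law
of `ε = zᵀ z` with `noiseLaw`, constants included (`lintegral_proposal_gram`). That `noiseLaw` has
mass one follows from the same identity.

For the symmetry, multiplying the matrix under the determinant by `ε^{1/2}` on both sides exchanges
`ε` with `ε⁻¹` at the cost of transposing `U₁`. As `U₁` is the top left block of a Haar orthogonal
matrix `R`, the transposition is absorbed by `R ↦ R⁻¹` (`noiseDensity_inv`); `μ` is itself invariant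
under inversion.

The Jacobians of the Gram map and of matrix inversion are never computed. Instead, a measure on the
positive definite cone invariant under all `S ↦ A S Aᵀ` is a multiple of `μ`
(`exists_lintegral_eq_mul_muP`). The remaining scalar is found by testing on a Gaussian for the Gram
map, and from being an involution for inversion. Only Jacobians of linear maps enter, and these are
read off from diagonal matrices. -/

/-- Conjugating by a diagonal matrix that doubles one coordinate turns a transvection into its
square, so its image `t` under `χ` satisfies `t² = t`; it is nonzero because transvections are
invertible. -/
theorem monoidHom_transvection {n : Type*} [Fintype n] [DecidableEq n]
    (χ : Matrix n n ℝ →* ℝ) {i j : n} (hij : i ≠ j) (c : ℝ) : χ (transvection i j c) = 1 := by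
  have hD : diagonal (Function.update (1 : n → ℝ) i 2) *
      diagonal (Function.update (1 : n → ℝ) i (1 / 2)) = 1 := by
    rw [diagonal_mul_diagonal, ← diagonal_one]
    congr 1
    ext k
    by_cases hk : k = i
    · subst hk; simp
    · simp [hk]
  have h1 : diagonal (Function.update (1 : n → ℝ) i 2) * transvection i j c *
      diagonal (Function.update (1 : n → ℝ) i (1 / 2)) = transvection i j (c + c) := by
    rw [transvection, mul_add, add_mul, mul_one, hD, transvection]
    congr 1
    ext k l
    rw [mul_diagonal, diagonal_mul]
    by_cases hk : i = k
    · subst hk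
      by_cases hl : j = l
      · subst hl; simp [hij.symm]; ring
      · simp [hl]
    · simp [hk]
  have h2 := congrArg χ h1
  rw [← transvection_mul_transvection_same i j hij, map_mul, map_mul, map_mul] at h2
  have h3 := congrArg χ hD
  rw [map_mul, map_one] at h3
  have h4 := congrArg χ (transvection_mul_transvection_same i j hij c (-c))
  rw [map_mul, add_neg_cancel, transvection_zero, map_one] at h4
  have h5 : χ (transvection i j c) ≠ 0 := left_ne_zero_of_mul_eq_one h4
  have h6 : χ (transvection i j c) * χ (transvection i j c) = 1 * χ (transvection i j c) := by
    rw [one_mul, ← h2, mul_right_comm, h3, one_mul]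
  exact mul_right_cancel₀ h5 h6

/-- Invertible matrices are products of diagonal matrices and transvections, and the latter are
invisible to `χ` and `χ'`. Determinants of matrix actions can thus be computed on diagonal matrices
alone. -/
theorem monoidHom_eq_of_diagonal {n : Type*} [Fintype n] [DecidableEq n]
    (χ χ' : Matrix n n ℝ →* ℝ) (h : ∀ d, χ (diagonal d) = χ' (diagonal d))
    {A : Matrix n n ℝ} (hA : A.det ≠ 0) : χ A = χ' A := by
  refine diagonal_transvection_induction_of_det_ne_zero (fun A => χ A = χ' A) A hA
    (fun d _ => h d) (fun t => ?_) (fun A B _ _ hA hB => ?_)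
  · rw [TransvectionStruct.toMatrix, monoidHom_transvection χ t.hij,
      monoidHom_transvection χ' t.hij]
  · simp only [map_mul, hA, hB]

/-- Left multiplication on matrices, as a linear endomorphism. -/
def mulLeftEnd (p q : ℕ) : Matrix (Fin p) (Fin p) ℝ →* Module.End ℝ (Fin p → Fin q → ℝ) where
  toFun B := mulLeftLinearMap (Fin q) ℝ B
  map_one' := LinearMap.ext fun X => Matrix.one_mul X
  map_mul' A B := by
    refine LinearMap.ext fun X => ?_
    exact Matrix.mul_assoc A B X

theorem det_mulLeftEnd {p : ℕ} (q : ℕ) {B : Matrix (Fin p) (Fin p) ℝ} (hB : B.det ≠ 0) :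
    LinearMap.det (mulLeftEnd p q B) = B.det ^ q := by
  refine monoidHom_eq_of_diagonal ((LinearMap.det).comp (mulLeftEnd p q))
    ((powMonoidHom q).comp detMonoidHom) (fun d => ?_) hB
  have : mulLeftEnd p q (diagonal d) =
      LinearMap.pi fun i => (d i • LinearMap.id : Module.End ℝ (Fin q → ℝ)).comp
        (LinearMap.proj i) := by
    refine LinearMap.ext fun X => ?_
    ext i j
    exact diagonal_mul d X i j
  simp only [MonoidHom.comp_apply, this, LinearMap.det_pi, powMonoidHom_apply,
    coe_detMonoidHom, det_diagonal]
  simp [Finset.prod_pow]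

theorem det_mulRight {q : ℕ} (p : ℕ) (D : Matrix (Fin q) (Fin q) ℝ) :
    LinearMap.det (LinearMap.pi fun i : Fin p => (toLin' Dᵀ).comp (LinearMap.proj i)) =
      D.det ^ p := by
  rw [LinearMap.det_pi]
  simp

/-! ### Linear changes of variables -/

theorem mul_det_lintegral_comp_linearMap {E : Type*} [NormedAddCommGroup E] [NormedSpace ℝ E]
    [MeasurableSpace E] [BorelSpace E] [FiniteDimensional ℝ E] (μ : Measure E)
    [μ.IsAddHaarMeasure] {f : E →ₗ[ℝ] E} (hf : LinearMap.det f ≠ 0) {h : E → ℝ≥0∞}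
    (hh : Measurable h) :
    ENNReal.ofReal |LinearMap.det f| * ∫⁻ x, h (f x) ∂μ = ∫⁻ x, h x ∂μ := by
  have hm : Measurable f := f.continuous_of_finiteDimensional.measurable
  rw [← lintegral_map hh hm, Measure.map_linearMap_addHaar_eq_smul_addHaar μ hf,
    lintegral_smul_measure, smul_eq_mul, ← mul_assoc, ← ENNReal.ofReal_mul (abs_nonneg _),
    abs_inv, mul_inv_cancel₀ (abs_ne_zero.mpr hf), ENNReal.ofReal_one, one_mul]

instance sigmaFinite_lebM (p q : ℕ) : SigmaFinite (lebM p q) := by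
  unfold lebM
  exact inferInstanceAs (SigmaFinite (volume : Measure (Fin p → Fin q → ℝ)))

/-- Change of variables `X ↦ B X D` in the Lebesgue measure on matrices. -/
theorem lintegral_lebM_mul {p q : ℕ} {B : Matrix (Fin p) (Fin p) ℝ}
    {D : Matrix (Fin q) (Fin q) ℝ} (hB : B.det ≠ 0) (hD : D.det ≠ 0)
    {h : Matrix (Fin p) (Fin q) ℝ → ℝ≥0∞} (hh : Measurable h) :
    ENNReal.ofReal (|B.det| ^ q * |D.det| ^ p) * ∫⁻ X, h (B * X * D) ∂(lebM p q) =
      ∫⁻ X, h X ∂(lebM p q) := by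
  have hR : ∀ X : Matrix (Fin p) (Fin q) ℝ,
      (LinearMap.pi fun i : Fin p => (toLin' Dᵀ).comp (LinearMap.proj i)) X = X * D := by
    intro X
    ext i j
    change (Dᵀ *ᵥ X i) j = _
    simp [mul_apply, mulVec, dotProduct, mul_comm]
  have hhD : Measurable fun X : Matrix (Fin p) (Fin q) ℝ => h (X * D) :=
    hh.comp (Continuous.measurable (by fun_prop))
  have h1 := mul_det_lintegral_comp_linearMap (volume : Measure (Fin p → Fin q → ℝ))
    (f := LinearMap.pi fun i : Fin p => (toLin' Dᵀ).comp (LinearMap.proj i))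
    (by rw [det_mulRight]; exact pow_ne_zero _ hD) (h := h) hh
  have h2 := mul_det_lintegral_comp_linearMap (volume : Measure (Fin p → Fin q → ℝ))
    (f := mulLeftEnd p q B) (by rw [det_mulLeftEnd q hB]; exact pow_ne_zero _ hB)
    (h := fun X => h ((show Matrix (Fin p) (Fin q) ℝ from X) * D)) hhD
  rw [det_mulRight, abs_pow] at h1
  rw [det_mulLeftEnd q hB, abs_pow] at h2
  have h1' : ENNReal.ofReal (|D.det| ^ p) * ∫⁻ X, h (X * D) ∂(lebM p q) =
      ∫⁻ X, h X ∂(lebM p q) := by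
    simp only [← hR]
    exact h1
  rw [mul_comm (_ ^ q), ENNReal.ofReal_mul (by positivity), mul_assoc, ← h1']
  exact congrArg _ h2

/-- The action `S ↦ A S Aᵀ` on symmetric matrices, in the coordinates above the diagonal. -/
def symEnd (q : ℕ) : Matrix (Fin q) (Fin q) ℝ →*
    Module.End ℝ ({ij : Fin q × Fin q // ij.1 ≤ ij.2} → ℝ) := by
  -- Since `A S Aᵀ` is symmetric, reading its upper triangle and rebuilding loses nothing; this
  -- makes the action multiplicative.
  have key : ∀ (A : Matrix (Fin q) (Fin q) ℝ) v, symOfUpper (fun ij : {ij : Fin q × Fin q //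
      ij.1 ≤ ij.2} => (A * symOfUpper v * Aᵀ) ij.1.1 ij.1.2) = A * symOfUpper v * Aᵀ := by
    intro A v
    have hs : (symOfUpper v)ᵀ = symOfUpper v := by
      ext i j
      simp [symOfUpper, min_comm, max_comm]
    have hs' : (A * symOfUpper v * Aᵀ)ᵀ = A * symOfUpper v * Aᵀ := by
      simp [hs, Matrix.mul_assoc]
    ext i j
    rcases le_total i j with hij | hij
    · simp [symOfUpper, hij]
    · conv_rhs => rw [← hs']
      simp [symOfUpper, hij]
  exact
  { toFun := fun A =>
      { toFun := fun v ij => (A * symOfUpper v * Aᵀ) ij.1.1 ij.1.2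
        map_add' := fun v w => by
          have : symOfUpper (v + w) = symOfUpper v + symOfUpper w := by
            ext i j; simp [symOfUpper]
          ext ij
          simp [this, Matrix.mul_add, Matrix.add_mul]
        map_smul' := fun c v => by
          have : symOfUpper (c • v) = c • symOfUpper v := by
            ext i j; simp [symOfUpper]
          ext ij
          simp [this] }
    map_one' := by
      refine LinearMap.ext fun v => ?_
      ext ⟨⟨i, j⟩, hij⟩
      have hij : i ≤ j := hij
      simp [symOfUpper, hij]
    map_mul' := fun A B => by
      refine LinearMap.ext fun v => ?_
      ext ij
      simp only [Module.End.mul_apply, LinearMap.coe_mk, AddHom.coe_mk, key]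
      simp only [Matrix.mul_assoc, transpose_mul] }

theorem symOfUpper_transpose {q : ℕ} (v : {ij : Fin q × Fin q // ij.1 ≤ ij.2} → ℝ) :
    (symOfUpper v)ᵀ = symOfUpper v := by
  ext i j
  simp [symOfUpper, min_comm, max_comm]

theorem symOfUpper_upper {q : ℕ} {S : Matrix (Fin q) (Fin q) ℝ} (hS : Sᵀ = S) :
    symOfUpper (fun ij => S ij.1.1 ij.1.2) = S := by
  ext i j
  rcases le_total i j with hij | hij
  · simp [symOfUpper, hij]
  · conv_rhs => rw [← hS]
    simp [symOfUpper, hij]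

theorem symOfUpper_symEnd {q : ℕ} (A : Matrix (Fin q) (Fin q) ℝ) (v) :
    symOfUpper (symEnd q A v) = A * symOfUpper v * Aᵀ :=
  symOfUpper_upper (S := A * symOfUpper v * Aᵀ) (by simp [symOfUpper_transpose, Matrix.mul_assoc])

/-- Each index meets every index once as smaller or larger partner, and itself twice, whence the
exponent `q + 1`. -/
theorem prod_upper {q : ℕ} (d : Fin q → ℝ) :
    ∏ ij : {ij : Fin q × Fin q // ij.1 ≤ ij.2}, d ij.1.1 * d ij.1.2 = (∏ i, d i) ^ (q + 1) := by
  have h (f : Fin q × Fin q → ℝ) : ∏ ij : {ij : Fin q × Fin q // ij.1 ≤ ij.2}, f ij.1 =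
      ∏ i, ∏ j, if i ≤ j then f (i, j) else 1 := by
    rw [← Fintype.prod_prod_type' (f := fun i j => if i ≤ j then f (i, j) else 1),
      ← Finset.prod_filter]
    exact (Finset.prod_subtype (p := fun ij : Fin q × Fin q => ij.1 ≤ ij.2) _ (by simp) f).symm
  rw [Finset.prod_mul_distrib, h fun ij => d ij.1, h fun ij => d ij.2, Finset.prod_comm
    (f := fun i j => if i ≤ j then d j else 1), ← Finset.prod_mul_distrib, ← Finset.prod_pow]
  refine Finset.prod_congr rfl fun i _ => ?_
  rw [← Finset.prod_mul_distrib]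
  have h' (j : Fin q) : ((if i ≤ j then d i else 1) * if j ≤ i then d i else 1) =
      d i * if j = i then d i else 1 := by
    rcases lt_trichotomy i j with hij | rfl | hij
    · simp [hij.le, hij.not_ge, hij.ne']
    · simp
    · simp [hij.le, hij.not_ge, hij.ne]
  simp only [h', Finset.prod_mul_distrib]
  simp [pow_succ]

theorem det_symEnd {q : ℕ} {A : Matrix (Fin q) (Fin q) ℝ} (hA : A.det ≠ 0) :
    LinearMap.det (symEnd q A) = A.det ^ (q + 1) := by
  refine monoidHom_eq_of_diagonal ((LinearMap.det).comp (symEnd q))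
    ((powMonoidHom (q + 1)).comp detMonoidHom) (fun d => ?_) hA
  have : symEnd q (diagonal d) = toLin' (diagonal fun ij => d ij.1.1 * d ij.1.2) := by
    refine LinearMap.ext fun v => ?_
    ext ⟨⟨i, j⟩, hij⟩
    have hij : i ≤ j := hij
    change (diagonal d * symOfUpper v * (diagonal d)ᵀ) i j = _
    rw [diagonal_transpose, mul_diagonal, diagonal_mul, toLin'_apply, mulVec_diagonal]
    simp [symOfUpper, hij]
    ring
  simp only [MonoidHom.comp_apply, this, powMonoidHom_apply, LinearMap.det_toLin',
    coe_detMonoidHom, det_diagonal, prod_upper]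

/-! ### Positive definite matrices and their square roots -/

section PosDef

variable {p q : ℕ}

theorem posDef_conj {A S : Matrix (Fin q) (Fin q) ℝ} (hS : S.PosDef) (hA : A.det ≠ 0) :
    (A * S * Aᵀ).PosDef := by
  have := (((isUnit_iff_isUnit_det A).mpr hA.isUnit).posDef_star_right_conjugate_iff
    (x := S)).mpr hS
  rwa [star_eq_conjTranspose, conjTranspose_eq_transpose_of_trivial] at this

theorem posDef_conj_iff {A S : Matrix (Fin q) (Fin q) ℝ} (hA : A.det ≠ 0) :
    (A * S * Aᵀ).PosDef ↔ S.PosDef := by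
  have := (((isUnit_iff_isUnit_det A).mpr hA.isUnit).posDef_star_right_conjugate_iff (x := S))
  rwa [star_eq_conjTranspose, conjTranspose_eq_transpose_of_trivial] at this

theorem posDef_transpose {S : Matrix (Fin q) (Fin q) ℝ} (hS : S.PosDef) : Sᵀ = S := by
  have := hS.isHermitian.eq
  rwa [conjTranspose_eq_transpose_of_trivial] at this

theorem posDef_transpose_mul_mul {U : Matrix (Fin p) (Fin p) ℝ} (hU : U.PosDef)
    {x : Matrix (Fin p) (Fin q) ℝ} (hx : (xᵀ * U * x).det ≠ 0) : (xᵀ * U * x).PosDef := by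
  have h := hU.posSemidef.conjTranspose_mul_mul_same x
  rw [conjTranspose_eq_transpose_of_trivial] at h
  exact h.posDef_iff_det_ne_zero.mpr hx

theorem posDef_transpose_mul_self {x : Matrix (Fin p) (Fin q) ℝ} (hx : (xᵀ * x).det ≠ 0) :
    (xᵀ * x).PosDef := by
  simpa using posDef_transpose_mul_mul (U := 1) PosDef.one (x := x) (by simpa using hx)

theorem isClosed_posSemidef : IsClosed {S : Matrix (Fin q) (Fin q) ℝ | S.PosSemidef} := by
  have h : {S : Matrix (Fin q) (Fin q) ℝ | S.PosSemidef} =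
      {S | Sᴴ = S} ∩ (⋂ x : Fin q → ℝ, {S | 0 ≤ star x ⬝ᵥ (S *ᵥ x)}) := by
    ext S
    rw [Set.mem_inter_iff, Set.mem_iInter]
    exact posSemidef_iff_dotProduct_mulVec
  rw [h]
  refine IsClosed.inter ?_ (isClosed_iInter fun x => ?_)
  · exact isClosed_eq (by fun_prop) (by fun_prop)
  · exact isClosed_le (by fun_prop) (by fun_prop)

theorem measurableSet_posDef : MeasurableSet {S : Matrix (Fin q) (Fin q) ℝ | S.PosDef} := by
  have h : {S : Matrix (Fin q) (Fin q) ℝ | S.PosDef} =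
      {S | S.PosSemidef} ∩ {S | S.det = 0}ᶜ := by
    ext S
    exact ⟨fun h => ⟨h.posSemidef, h.det_pos.ne'⟩, fun h => h.1.posDef_iff_det_ne_zero.mpr h.2⟩
  rw [h]
  exact isClosed_posSemidef.measurableSet.inter
    (isClosed_eq (by fun_prop) (by fun_prop)).measurableSet.compl

open scoped MatrixOrder in
theorem posDef_psqrt {S : Matrix (Fin q) (Fin q) ℝ} (hS : S.PosDef) : (psqrt S).PosDef := by
  have h : (psqrt S).PosSemidef := (CFC.sqrt_nonneg S).posSemidef
  refine h.posDef_iff_det_ne_zero.mpr fun h0 => hS.det_pos.ne' ?_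
  rw [← CFC.sqrt_mul_sqrt_self S hS.posSemidef.nonneg, det_mul]
  change (psqrt S).det * (psqrt S).det = 0
  rw [h0, zero_mul]

open scoped MatrixOrder in
theorem psqrt_mul_self {S : Matrix (Fin q) (Fin q) ℝ} (hS : S.PosDef) :
    psqrt S * psqrt S = S := CFC.sqrt_mul_sqrt_self S hS.posSemidef.nonneg

open scoped MatrixOrder in
theorem psqrt_unique {S T : Matrix (Fin q) (Fin q) ℝ} (hT : T.PosDef) (h : T * T = S) :
    psqrt S = T := CFC.sqrt_unique h hT.posSemidef.nonneg

theorem psqrt_transpose {S : Matrix (Fin q) (Fin q) ℝ} (hS : S.PosDef) :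
    (psqrt S)ᵀ = psqrt S := posDef_transpose (posDef_psqrt hS)

theorem psqrt_inv {S : Matrix (Fin q) (Fin q) ℝ} (hS : S.PosDef) :
    psqrt S⁻¹ = (psqrt S)⁻¹ :=
  psqrt_unique (posDef_psqrt hS).inv (by rw [← Matrix.mul_inv_rev, psqrt_mul_self hS])

theorem det_psqrt_pos {S : Matrix (Fin q) (Fin q) ℝ} (hS : S.PosDef) : 0 < (psqrt S).det :=
  (posDef_psqrt hS).det_pos

theorem det_psqrt_sq {S : Matrix (Fin q) (Fin q) ℝ} (hS : S.PosDef) :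
    (psqrt S).det ^ 2 = S.det := by
  rw [sq, ← det_mul, psqrt_mul_self hS]

theorem det_psqrt_pow {S : Matrix (Fin q) (Fin q) ℝ} (hS : S.PosDef) (n : ℕ) :
    (psqrt S).det ^ n = S.det ^ ((n : ℝ) / 2) := by
  rw [← det_psqrt_sq hS, ← Real.rpow_natCast _ 2, ← Real.rpow_mul (det_psqrt_pos hS).le,
    ← Real.rpow_natCast]
  congr 1
  push_cast
  ring

theorem psqrt_inv_mul {S : Matrix (Fin q) (Fin q) ℝ} (hS : S.PosDef) :
    (psqrt S)⁻¹ * psqrt S = 1 := nonsing_inv_mul _ (det_psqrt_pos hS).ne'.isUnit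

theorem psqrt_mul_inv {S : Matrix (Fin q) (Fin q) ℝ} (hS : S.PosDef) :
    psqrt S * (psqrt S)⁻¹ = 1 := mul_nonsing_inv _ (det_psqrt_pos hS).ne'.isUnit

-- The square root is continuous on the closed set of positive semidefinite matrices and takes the
-- default value `0` elsewhere.
open scoped MatrixOrder Matrix.Norms.L2Operator in
theorem measurable_psqrt : Measurable (psqrt : Matrix (Fin q) (Fin q) ℝ → _) := by
  classical
  have hs : IsClosed {A : Matrix (Fin q) (Fin q) ℝ | 0 ≤ A} := by
    simpa only [nonneg_iff_posSemidef] using isClosed_posSemidef (q := q)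
  have h : (psqrt : Matrix (Fin q) (Fin q) ℝ → _) =
      Set.piecewise {A | 0 ≤ A} CFC.sqrt fun _ => 0 := by
    ext1 A
    by_cases hA : 0 ≤ A
    · simp [psqrt, hA]
    · rw [Set.piecewise_eq_of_notMem _ _ _ (by exact hA)]
      exact cfcₙ_apply_of_not_predicate _ hA
  rw [h]
  exact CFC.continuousOn_sqrt.measurable_piecewise continuousOn_const hs.measurableSet

end PosDef

/-! ### Measurability of matrix operations -/

section Measurability

variable {α : Type*} [MeasurableSpace α] {l m n : ℕ}

instance secondCountableTopology_matrix (m n : Type*) [Countable m] [Countable n] :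
    SecondCountableTopology (Matrix m n ℝ) :=
  inferInstanceAs (SecondCountableTopology (m → n → ℝ))

@[fun_prop]
theorem measurable_matrix_mul {f : α → Matrix (Fin l) (Fin m) ℝ} {g : α → Matrix (Fin m) (Fin n) ℝ}
    (hf : Measurable f) (hg : Measurable g) : Measurable fun a => f a * g a := by
  have h : Measurable fun z : Matrix (Fin l) (Fin m) ℝ × Matrix (Fin m) (Fin n) ℝ => z.1 * z.2 :=
    Continuous.measurable (by fun_prop)
  exact h.comp (hf.prodMk hg)

@[fun_prop]
theorem measurable_matrix_transpose {f : α → Matrix (Fin l) (Fin m) ℝ} (hf : Measurable f) :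
    Measurable fun a => (f a)ᵀ := by
  have h : Measurable fun z : Matrix (Fin l) (Fin m) ℝ => zᵀ := Continuous.measurable (by fun_prop)
  exact h.comp hf

@[fun_prop]
theorem measurable_matrix_submatrix {f : α → Matrix (Fin l) (Fin m) ℝ} (hf : Measurable f)
    {l' m' : ℕ} (e₁ : Fin l' → Fin l) (e₂ : Fin m' → Fin m) :
    Measurable fun a => (f a).submatrix e₁ e₂ := by
  have h : Measurable fun z : Matrix (Fin l) (Fin m) ℝ => z.submatrix e₁ e₂ :=
    (continuous_id.matrix_submatrix _ _).measurable
  exact h.comp hf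

@[fun_prop]
theorem measurable_matrix_det {f : α → Matrix (Fin n) (Fin n) ℝ} (hf : Measurable f) :
    Measurable fun a => (f a).det := by
  have h : Measurable fun z : Matrix (Fin n) (Fin n) ℝ => z.det :=
    Continuous.measurable (by fun_prop)
  exact h.comp hf

@[fun_prop]
theorem measurable_matrix_trace {f : α → Matrix (Fin n) (Fin n) ℝ} (hf : Measurable f) :
    Measurable fun a => (f a).trace := by
  have h : Measurable fun z : Matrix (Fin n) (Fin n) ℝ => z.trace :=
    Continuous.measurable (by fun_prop)
  exact h.comp hf

@[fun_prop]
theorem measurable_matrix_inv {f : α → Matrix (Fin n) (Fin n) ℝ} (hf : Measurable f) :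
    Measurable fun a => (f a)⁻¹ := by
  have h : Measurable fun A : Matrix (Fin n) (Fin n) ℝ => A⁻¹ := by
    simp only [inv_def, Ring.inverse_eq_inv']
    refine measurable_pi_lambda _ fun i => measurable_pi_lambda _ fun j => ?_
    simp only [Matrix.smul_apply, smul_eq_mul]
    refine Measurable.mul (Measurable.inv (Continuous.measurable (by fun_prop))) ?_
    exact (Continuous.measurable (by fun_prop) : Measurable fun A : Matrix (Fin n) (Fin n) ℝ =>
      A.adjugate i j)
  exact h.comp hf

@[fun_prop]
theorem measurable_psqrt_comp {f : α → Matrix (Fin n) (Fin n) ℝ} (hf : Measurable f) :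
    Measurable fun a => psqrt (f a) := measurable_psqrt.comp hf

end Measurability

/-! ### Null sets of singular matrices -/

/-- Along each line `X + t E` the determinant is a characteristic polynomial in `t`, hence has
finitely many zeros. By Fubini and translation invariance, the measure of the singular set times the
infinite length of the line is `0`. -/
theorem ae_det_submatrix_ne_zero {p q : ℕ} (hqp : q ≤ p) :
    ∀ᵐ X ∂(lebM p q), (X.submatrix (Fin.castLE hqp) id).det ≠ 0 := by
  set N : Set (Matrix (Fin p) (Fin q) ℝ) := {X | (X.submatrix (Fin.castLE hqp) id).det = 0}
  have hN : MeasurableSet N :=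
    (isClosed_eq (Continuous.matrix_det (continuous_id.matrix_submatrix _ _))
      continuous_const).measurableSet
  set E : Matrix (Fin p) (Fin q) ℝ := (1 : Matrix (Fin p) (Fin p) ℝ).submatrix id (Fin.castLE hqp)
  have hE : E.submatrix (Fin.castLE hqp) id = 1 := by
    ext i j
    simp [E, one_apply]
  have h1 : ∫⁻ t : ℝ, ∫⁻ X, N.indicator 1 (X + t • E) ∂(lebM p q) = 0 := by
    rw [lintegral_lintegral_swap]
    · refine (lintegral_congr fun X => ?_).trans lintegral_zero
      have hfin : {t : ℝ | X + t • E ∈ N}.Finite := by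
        refine (Polynomial.finite_setOfPred_isRoot (p := (-X.submatrix (Fin.castLE hqp) id).charpoly)
          (charpoly_monic _).ne_zero).subset fun t ht => ?_
        have ht : ((X + t • E).submatrix (Fin.castLE hqp) id).det = 0 := ht
        change Polynomial.eval t (charpoly _) = 0
        rw [eval_charpoly, ← ht]
        congr 1
        ext i j
        have := congrFun (congrFun hE i) j
        simp only [submatrix_apply, id] at this
        simp [this, one_apply, diagonal_apply, add_comm]
      have : (fun t : ℝ => N.indicator (1 : Matrix (Fin p) (Fin q) ℝ → ℝ≥0∞) (X + t • E)) =
          {t : ℝ | X + t • E ∈ N}.indicator 1 := by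
        ext t; rfl
      rw [this, lintegral_indicator_one hfin.measurableSet, hfin.measure_zero]
    · refine (Measurable.comp (measurable_one.indicator hN) ?_).aemeasurable
      exact Continuous.measurable (by fun_prop)
  have h2 (t : ℝ) : ∫⁻ X, N.indicator 1 (X + t • E) ∂(lebM p q) = lebM p q N := by
    rw [← lintegral_indicator_one hN]
    exact lintegral_add_right_eq_self (μ := (volume : Measure (Fin p → Fin q → ℝ))) _ _
  simp only [h2, lintegral_const, Real.volume_univ] at h1
  rw [ae_iff]
  simpa [N] using h1

theorem det_transpose_mul_self_ne_zero {p q : ℕ} (hqp : q ≤ p) {X : Matrix (Fin p) (Fin q) ℝ}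
    (hX : (X.submatrix (Fin.castLE hqp) id).det ≠ 0) : (Xᵀ * X).det ≠ 0 := by
  have h : (Xᵀ * X).PosDef := by
    rw [← conjTranspose_eq_transpose_of_trivial]
    refine PosDef.conjTranspose_mul_self X fun v w hvw => ?_
    have := mulVec_injective_of_isUnit ((isUnit_iff_isUnit_det _).mpr hX.isUnit)
    refine this ?_
    ext i
    exact congrFun hvw (Fin.castLE hqp i)
  exact h.det_pos.ne'

theorem ae_posDef_transpose_mul_self {p q : ℕ} (hqp : q ≤ p) :
    ∀ᵐ X ∂(lebM p q), (Xᵀ * X).PosDef := by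
  filter_upwards [ae_det_submatrix_ne_zero hqp] with X hX
  exact posDef_transpose_mul_self (det_transpose_mul_self_ne_zero hqp hX)

theorem ae_det_ne_zero (q : ℕ) : ∀ᵐ X ∂(lebM q q), X.det ≠ 0 := by
  filter_upwards [ae_det_submatrix_ne_zero le_rfl] with X hX
  exact hX

/-! ### The invariant measure on positive definite matrices -/

theorem continuous_symOfUpper {q : ℕ} : Continuous (symOfUpper (q := q)) :=
  continuous_matrix fun _ _ => continuous_apply _

theorem measurable_muP_density (q : ℕ) : Measurable fun S : Matrix (Fin q) (Fin q) ℝ =>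
    ENNReal.ofReal (S.det ^ (-((q : ℝ) + 1) / 2)) := by
  fun_prop

theorem ae_posDef_muP (q : ℕ) : ∀ᵐ S ∂(muP q), S.PosDef :=
  (withDensity_absolutelyContinuous _ _).ae_le (ae_restrict_mem measurableSet_posDef)

theorem lintegral_muP {q : ℕ} {g : Matrix (Fin q) (Fin q) ℝ → ℝ≥0∞} (hg : Measurable g) :
    ∫⁻ S, g S ∂(muP q) = ∫⁻ v, {S : Matrix (Fin q) (Fin q) ℝ | S.PosDef}.indicator
      (fun S => ENNReal.ofReal (S.det ^ (-((q : ℝ) + 1) / 2)) * g S) (symOfUpper v) := by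
  have hd := measurable_muP_density q
  rw [muP, lintegral_withDensity_eq_lintegral_mul _ hd hg,
    ← lintegral_indicator measurableSet_posDef,
    lintegral_map ((hd.mul hg).indicator measurableSet_posDef) continuous_symOfUpper.measurable]
  rfl

/-- Needed for the σ-finiteness of `muP`, which the Fubini arguments rely on: σ-finiteness does not
pass to arbitrary images. -/
theorem measurableEmbedding_symOfUpper (q : ℕ) : MeasurableEmbedding (symOfUpper (q := q)) := by
  have hr : Set.range (symOfUpper (q := q)) = {S | Sᵀ = S} := by
    ext S
    constructor
    · rintro ⟨v, rfl⟩
      exact symOfUpper_transpose v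
    · exact fun h => ⟨_, symOfUpper_upper h⟩
  refine MeasurableEmbedding.of_measurable_inverse (g := fun S ij => S ij.1.1 ij.1.2)
    continuous_symOfUpper.measurable ?_ ?_ ?_
  · rw [hr]
    exact (isClosed_eq (by fun_prop) (by fun_prop)).measurableSet
  · exact Continuous.measurable (by fun_prop)
  · rintro v
    ext ⟨⟨i, j⟩, hij⟩
    have hij : i ≤ j := hij
    simp [symOfUpper, hij]

instance sigmaFinite_muP (q : ℕ) : SigmaFinite (muP q) := by
  have := (measurableEmbedding_symOfUpper q).sigmaFinite_map
    (μ := (volume : Measure ({ij : Fin q × Fin q // ij.1 ≤ ij.2} → ℝ)))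
  exact SigmaFinite.withDensity_of_ne_top (by simp)

/-- The Jacobian `|det A| ^ (q + 1)` is exactly cancelled by the weight `det ^ (-(q + 1) / 2)`, as
the determinant of `A S Aᵀ` carries `|det A| ^ 2`. -/
theorem lintegral_muP_conj {q : ℕ} {A : Matrix (Fin q) (Fin q) ℝ} (hA : A.det ≠ 0)
    {g : Matrix (Fin q) (Fin q) ℝ → ℝ≥0∞} (hg : Measurable g) :
    ∫⁻ S, g (A * S * Aᵀ) ∂(muP q) = ∫⁻ S, g S ∂(muP q) := by
  set F : Matrix (Fin q) (Fin q) ℝ → ℝ≥0∞ := {S | S.PosDef}.indicator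
    (fun S => ENNReal.ofReal (S.det ^ (-((q : ℝ) + 1) / 2)) * g S) with hF
  have hFm : Measurable F :=
    ((measurable_muP_density q).mul hg).indicator measurableSet_posDef
  rw [lintegral_muP hg, lintegral_muP (g := fun S => g (A * S * Aᵀ)) (by fun_prop),
    ← mul_det_lintegral_comp_linearMap volume (f := symEnd q A)
      (by rw [det_symEnd hA]; exact pow_ne_zero _ hA) (h := fun v => F (symOfUpper v))
      (hFm.comp continuous_symOfUpper.measurable), det_symEnd hA,
    ← lintegral_const_mul' _ _ ENNReal.ofReal_ne_top]
  refine lintegral_congr fun v => ?_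
  rw [symOfUpper_symEnd, hF]
  by_cases hS : (symOfUpper v).PosDef
  · rw [Set.indicator_of_mem (by exact hS), Set.indicator_of_mem (by exact posDef_conj hS hA),
      ← mul_assoc, ← ENNReal.ofReal_mul (abs_nonneg _)]
    congr 2
    have hA' : 0 < |A.det| := abs_pos.mpr hA
    have h1 : (A * symOfUpper v * Aᵀ).det = |A.det| ^ 2 * (symOfUpper v).det := by
      rw [det_mul, det_mul, det_transpose, sq_abs]
      ring
    rw [h1, Real.mul_rpow (by positivity) hS.det_pos.le, ← mul_assoc, abs_pow,
      ← Real.rpow_natCast |A.det| 2, ← Real.rpow_mul hA'.le, ← Real.rpow_natCast,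
      ← Real.rpow_add hA']
    push_cast
    rw [show (q : ℝ) + 1 + 2 * (-((q : ℝ) + 1) / 2) = 0 by ring, Real.rpow_zero, one_mul]
  · rw [Set.indicator_of_notMem (by exact hS),
      Set.indicator_of_notMem (by exact fun h => hS ((posDef_conj_iff hA).mp h)), mul_zero]

open scoped Matrix.Norms.L2Operator in
theorem exists_posDef_add {q : ℕ} {S : Matrix (Fin q) (Fin q) ℝ} (hS : Sᵀ = S) :
    ∃ n : ℕ, (S + (n : ℝ) • (1 : Matrix (Fin q) (Fin q) ℝ)).PosDef := by
  obtain ⟨n, hn⟩ := exists_nat_gt (‖S‖ * ‖(1 : Matrix (Fin q) (Fin q) ℝ)‖)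
  have hspec : ∀ r ∈ spectrum ℝ (S + (n : ℝ) • (1 : Matrix (Fin q) (Fin q) ℝ)), 0 < r := by
    intro r hr
    rw [← Algebra.algebraMap_eq_smul_one, add_comm S, ← sub_add_cancel r (n : ℝ),
      spectrum.add_mem_add_iff] at hr
    have h1 := spectrum.norm_le_norm_mul_of_mem hr
    have h2 := neg_abs_le (r - n)
    rw [Real.norm_eq_abs] at h1
    linarith
  have hH : (S + (n : ℝ) • (1 : Matrix (Fin q) (Fin q) ℝ)).IsHermitian := by
    rw [IsHermitian, conjTranspose_eq_transpose_of_trivial]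
    simp [hS]
  have hP : (S + (n : ℝ) • (1 : Matrix (Fin q) (Fin q) ℝ)).PosSemidef :=
    posSemidef_iff_isHermitian_and_spectrum_nonneg.mpr ⟨hH, fun r hr => (hspec r hr).le⟩
  refine ⟨n, hP.posDef_iff_isUnit.mpr (spectrum.isUnit_of_zero_notMem ℝ fun h => ?_)⟩
  exact lt_irrefl _ (hspec 0 h)

/-- The density is positive on the cone, so the cone would be Lebesgue null. But countably many of
its translates along the identity cover all symmetric matrices, by `exists_posDef_add`. -/
theorem muP_ne_zero (q : ℕ) : muP q ≠ 0 := by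
  intro h0
  set W : Set ({ij : Fin q × Fin q // ij.1 ≤ ij.2} → ℝ) := {v | (symOfUpper v).PosDef}
  have hW : MeasurableSet W := continuous_symOfUpper.measurable measurableSet_posDef
  have h1 : volume W = 0 := by
    have h := lintegral_muP (q := q) (g := fun S =>
      (ENNReal.ofReal (S.det ^ (-((q : ℝ) + 1) / 2)))⁻¹) (measurable_muP_density q).inv
    rw [h0, lintegral_zero_measure] at h
    rw [← lintegral_indicator_one hW, h]
    refine lintegral_congr fun v => ?_
    by_cases hv : (symOfUpper v).PosDef
    · rw [Set.indicator_of_mem (by exact hv), Set.indicator_of_mem (by exact hv),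
        ENNReal.mul_inv_cancel _ ENNReal.ofReal_ne_top]
      · rfl
      · have := Real.rpow_pos_of_pos hv.det_pos (-((q : ℝ) + 1) / 2)
        simpa using this
    · rw [Set.indicator_of_notMem (by exact hv), Set.indicator_of_notMem (by exact hv)]
  set e : {ij : Fin q × Fin q // ij.1 ≤ ij.2} → ℝ := fun ij =>
    (1 : Matrix (Fin q) (Fin q) ℝ) ij.1.1 ij.1.2
  have h2 : (Set.univ : Set ({ij : Fin q × Fin q // ij.1 ≤ ij.2} → ℝ)) =
      ⋃ n : ℕ, (fun v => v + (n : ℝ) • e) ⁻¹' W := by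
    refine (Set.eq_univ_of_forall fun v => ?_).symm
    obtain ⟨n, hn⟩ := exists_posDef_add (symOfUpper_transpose v)
    refine Set.mem_iUnion.mpr ⟨n, ?_⟩
    change (symOfUpper _).PosDef
    convert hn using 1
    have he : symOfUpper e = 1 := symOfUpper_upper (by simp)
    rw [← he]
    ext i j
    simp [symOfUpper]
  have h3 : volume (Set.univ : Set ({ij : Fin q × Fin q // ij.1 ≤ ij.2} → ℝ)) = 0 := by
    rw [h2]
    refine measure_iUnion_null fun n => ?_
    rw [measure_preimage_add_right]
    exact h1
  exact isOpen_univ.measure_ne_zero volume Set.univ_nonempty h3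

/-! ### Gaussian integrals and the invariant measure on invertible matrices -/

theorem trace_transpose_mul_self {p q : ℕ} (X : Matrix (Fin p) (Fin q) ℝ) :
    (Xᵀ * X).trace = ∑ i, ∑ j, X i j ^ 2 := by
  simp only [trace, diag_apply, mul_apply, transpose_apply]
  rw [Finset.sum_comm]
  simp [sq]

theorem lintegral_prod_exp_neg_sq (p q : ℕ) :
    ∫⁻ x : Fin p → Fin q → ℝ, ENNReal.ofReal (∏ i, ∏ j, Real.exp (-1 * x i j ^ 2)) =
      ENNReal.ofReal (Real.pi ^ ((p : ℝ) * q / 2)) := by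
  have hrow : Integrable (fun x : Fin q → ℝ => ∏ j, Real.exp (-1 * x j ^ 2)) :=
    Integrable.fintype_prod (f := fun _ (x : ℝ) => Real.exp (-1 * x ^ 2))
      fun _ => integrable_exp_neg_mul_sq one_pos
  have hint : Integrable (fun x : Fin p → Fin q → ℝ => ∏ i, ∏ j, Real.exp (-1 * x i j ^ 2)) :=
    Integrable.fintype_prod (f := fun _ (x : Fin q → ℝ) => ∏ j, Real.exp (-1 * x j ^ 2))
      fun _ => hrow
  rw [← ofReal_integral_eq_lintegral_ofReal hint
    (Filter.Eventually.of_forall fun x => by positivity)]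
  congr 1
  rw [integral_fintype_prod_volume_eq_prod (fun _ (x : Fin q → ℝ) => ∏ j, Real.exp (-1 * x j ^ 2))]
  simp only [integral_fintype_prod_volume_eq_prod (fun _ (x : ℝ) => Real.exp (-1 * x ^ 2)),
    integral_gaussian, Finset.prod_const, Finset.card_univ, Fintype.card_fin, div_one]
  rw [← pow_mul, Real.sqrt_eq_rpow, ← Real.rpow_natCast, ← Real.rpow_mul Real.pi_pos.le]
  congr 1
  push_cast
  ring

theorem lintegral_exp_neg_trace (p q : ℕ) :
    ∫⁻ X, ENNReal.ofReal (Real.exp (-(Xᵀ * X).trace)) ∂(lebM p q) =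
      ENNReal.ofReal (Real.pi ^ ((p : ℝ) * q / 2)) := by
  have h1 (X : Matrix (Fin p) (Fin q) ℝ) :
      Real.exp (-(Xᵀ * X).trace) = ∏ i, ∏ j, Real.exp (-1 * X i j ^ 2) := by
    rw [trace_transpose_mul_self]
    simp only [← Real.exp_sum, ← Finset.sum_neg_distrib, neg_mul, one_mul]
  simp only [h1]
  exact lintegral_prod_exp_neg_sq p q

/-- The measure `|det A|^{-q} dA`, a Haar measure of the general linear group. -/
noncomputable def haarGL (q : ℕ) : Measure (Matrix (Fin q) (Fin q) ℝ) :=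
  (lebM q q).withDensity fun A => ENNReal.ofReal (|A.det| ^ q)⁻¹

theorem measurable_haarGL_density (q : ℕ) : Measurable fun A : Matrix (Fin q) (Fin q) ℝ =>
    ENNReal.ofReal (|A.det| ^ q)⁻¹ := by
  have h : Measurable fun A : Matrix (Fin q) (Fin q) ℝ => |A.det| :=
    Measurable.norm (f := fun A : Matrix (Fin q) (Fin q) ℝ => A.det) (by fun_prop)
  fun_prop

instance sigmaFinite_haarGL (q : ℕ) : SigmaFinite (haarGL q) :=
  SigmaFinite.withDensity_of_ne_top (by simp)

theorem ae_det_ne_zero_haarGL (q : ℕ) : ∀ᵐ A ∂(haarGL q), A.det ≠ 0 :=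
  (withDensity_absolutelyContinuous _ _).ae_le (ae_det_ne_zero q)

theorem lintegral_haarGL {q : ℕ} {h : Matrix (Fin q) (Fin q) ℝ → ℝ≥0∞} (hh : Measurable h) :
    ∫⁻ A, h A ∂(haarGL q) = ∫⁻ A, ENNReal.ofReal (|A.det| ^ q)⁻¹ * h A ∂(lebM q q) :=
  lintegral_withDensity_eq_lintegral_mul _ (measurable_haarGL_density q) hh

/-- For square matrices left and right multiplication have Jacobians with the same exponent `q`, so
a single density gives invariance on both sides. -/
theorem lintegral_haarGL_mul {q : ℕ} {B D : Matrix (Fin q) (Fin q) ℝ} (hB : B.det ≠ 0)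
    (hD : D.det ≠ 0) {h : Matrix (Fin q) (Fin q) ℝ → ℝ≥0∞} (hh : Measurable h) :
    ∫⁻ A, h (B * A * D) ∂(haarGL q) = ∫⁻ A, h A ∂(haarGL q) := by
  rw [lintegral_haarGL hh, ← lintegral_lebM_mul hB hD
    (h := fun A => ENNReal.ofReal (|A.det| ^ q)⁻¹ * h A) ((measurable_haarGL_density q).mul hh),
    lintegral_haarGL (h := fun A => h (B * A * D)) (by fun_prop),
    ← lintegral_const_mul' _ _ ENNReal.ofReal_ne_top]
  refine lintegral_congr fun A => ?_
  rw [← mul_assoc, ← ENNReal.ofReal_mul (by positivity)]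
  congr 2
  have hB' : |B.det| ≠ 0 := abs_ne_zero.mpr hB
  have hD' : |D.det| ≠ 0 := abs_ne_zero.mpr hD
  simp only [det_mul, abs_mul, mul_pow, mul_inv]
  field_simp

/-! ### Uniqueness of the invariant measure -/

/-- An auxiliary weight on positive definite matrices. -/
noncomputable def invWeight (q : ℕ) (S : Matrix (Fin q) (Fin q) ℝ) : ℝ≥0∞ :=
  ENNReal.ofReal ((psqrt S).det⁻¹ ^ q * Real.exp (-(S⁻¹).trace))

@[fun_prop]
theorem measurable_invWeight (q : ℕ) : Measurable (invWeight q) := by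
  unfold invWeight
  fun_prop

/-- This identity dictates the choice of weight: its determinant factor cancels the density of
`haarGL` and leaves a Gaussian, whose integral is known. -/
theorem invWeight_inv {q : ℕ} {A : Matrix (Fin q) (Fin q) ℝ} (hA : A.det ≠ 0) :
    ENNReal.ofReal (|A.det| ^ q)⁻¹ * invWeight q (A⁻¹ * (A⁻¹)ᵀ) =
      ENNReal.ofReal (Real.exp (-(Aᵀ * A).trace)) := by
  have hA' : A⁻¹.det ≠ 0 := by
    rw [det_nonsing_inv, Ring.inverse_eq_inv']
    exact inv_ne_zero hA
  have hp : (A⁻¹ * (A⁻¹)ᵀ).PosDef := by simpa using posDef_conj PosDef.one hA'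
  have h1 : (psqrt (A⁻¹ * (A⁻¹)ᵀ)).det = |A.det|⁻¹ := by
    rw [← abs_of_pos (det_psqrt_pos hp), ← abs_inv, ← sq_eq_sq_iff_abs_eq_abs, det_psqrt_sq hp,
      det_mul, det_transpose, det_nonsing_inv, Ring.inverse_eq_inv', sq]
  have h2 : (A⁻¹ * (A⁻¹)ᵀ)⁻¹ = Aᵀ * A := by
    rw [Matrix.mul_inv_rev, transpose_nonsing_inv, nonsing_inv_nonsing_inv,
      nonsing_inv_nonsing_inv _ hA.isUnit]
    rw [det_transpose]; exact hA.isUnit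
  rw [invWeight, h1, h2, ← ENNReal.ofReal_mul (by positivity), inv_inv, ← mul_assoc,
    inv_mul_cancel₀ (pow_ne_zero _ (abs_ne_zero.mpr hA)), one_mul]

variable {q : ℕ} {ν : Measure (Matrix (Fin q) (Fin q) ℝ)}

theorem lintegral_haarGL_conj {S : Matrix (Fin q) (Fin q) ℝ} (hS : S.PosDef)
    {g : Matrix (Fin q) (Fin q) ℝ → ℝ≥0∞} (hg : Measurable g) :
    ∫⁻ A, g (A * S * Aᵀ) ∂(haarGL q) = ∫⁻ A, g (A * Aᵀ) ∂(haarGL q) := by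
  rw [← lintegral_haarGL_mul (B := 1) (by simp) (det_psqrt_pos hS).ne'
    (h := fun A => g (A * Aᵀ)) (by fun_prop)]
  refine lintegral_congr fun A => ?_
  rw [Matrix.one_mul, transpose_mul, psqrt_transpose hS, Matrix.mul_assoc A (psqrt S),
    ← Matrix.mul_assoc (psqrt S), psqrt_mul_self hS, Matrix.mul_assoc]

theorem lintegral_haarGL_invWeight {S : Matrix (Fin q) (Fin q) ℝ} (hS : S.PosDef) :
    ∫⁻ A, invWeight q (A⁻¹ * S * (A⁻¹)ᵀ) ∂(haarGL q) =
      ENNReal.ofReal (Real.pi ^ ((q : ℝ) * q / 2)) := by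
  have hm : Measurable fun A : Matrix (Fin q) (Fin q) ℝ => invWeight q (A⁻¹ * S * (A⁻¹)ᵀ) := by
    fun_prop
  have hm' : Measurable fun A : Matrix (Fin q) (Fin q) ℝ => invWeight q (A⁻¹ * (A⁻¹)ᵀ) := by
    fun_prop
  rw [← lintegral_haarGL_mul (D := 1) (det_psqrt_pos hS).ne' (by simp) hm,
    ← lintegral_exp_neg_trace, lintegral_congr (g := fun A => invWeight q (A⁻¹ * (A⁻¹)ᵀ)),
    lintegral_haarGL hm']
  · refine lintegral_congr_ae ?_
    filter_upwards [ae_det_ne_zero q] with A hA using invWeight_inv hA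
  · intro A
    have h1 : (psqrt S)⁻¹ * S * (psqrt S)⁻¹ = 1 := by
      nth_rw 2 [← psqrt_mul_self hS]
      rw [← Matrix.mul_assoc, psqrt_inv_mul hS, Matrix.one_mul, psqrt_mul_inv hS]
    have h2 : ((psqrt S)⁻¹)ᵀ = (psqrt S)⁻¹ := by rw [transpose_nonsing_inv, psqrt_transpose hS]
    have h3 : (psqrt S * A * 1)⁻¹ * S * ((psqrt S * A * 1)⁻¹)ᵀ =
        A⁻¹ * ((psqrt S)⁻¹ * S * (psqrt S)⁻¹) * (A⁻¹)ᵀ := by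
      rw [Matrix.mul_one, Matrix.mul_inv_rev, transpose_mul, h2]
      simp only [Matrix.mul_assoc]
    rw [h3, h1, Matrix.mul_one]

theorem lintegral_invWeight_conj
    (hinv : ∀ A : Matrix (Fin q) (Fin q) ℝ, A.det ≠ 0 →
      ∀ g : Matrix (Fin q) (Fin q) ℝ → ℝ≥0∞, Measurable g →
      ∫⁻ S, g (A * S * Aᵀ) ∂ν = ∫⁻ S, g S ∂ν)
    {g : Matrix (Fin q) (Fin q) ℝ → ℝ≥0∞} (hg : Measurable g)
    {A : Matrix (Fin q) (Fin q) ℝ} (hA : A.det ≠ 0) :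
    ∫⁻ S, invWeight q S * g (A * S * Aᵀ) ∂ν =
      ∫⁻ S, invWeight q (A⁻¹ * S * (A⁻¹)ᵀ) * g S ∂ν := by
  rw [← hinv A hA (fun S => invWeight q (A⁻¹ * S * (A⁻¹)ᵀ) * g S)
    (by fun_prop)]
  refine lintegral_congr fun S => ?_
  have hAi : A⁻¹ * A = 1 := nonsing_inv_mul _ hA.isUnit
  have h : A⁻¹ * (A * S * Aᵀ) * (A⁻¹)ᵀ = (A⁻¹ * A) * S * (A⁻¹ * A)ᵀ := by
    simp only [transpose_mul, Matrix.mul_assoc]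
  rw [h, hAi, transpose_one, Matrix.mul_one, Matrix.one_mul]

/-- Integrate `invWeight S * g (A S Aᵀ)` over `ν` and `haarGL` in both orders. With `S` fixed, right
invariance of `haarGL` removes `S` from the argument of `g`. With `A` fixed, invariance of `ν` moves
`A` onto the weight, whose integral over `A` is the Gaussian constant. Hence `ν` enters the result
only through one scalar. -/
theorem lintegral_mul_eq_haarGL [SFinite ν] (hν : ∀ᵐ S ∂ν, S.PosDef)
    (hinv : ∀ A : Matrix (Fin q) (Fin q) ℝ, A.det ≠ 0 →
      ∀ g : Matrix (Fin q) (Fin q) ℝ → ℝ≥0∞, Measurable g →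
      ∫⁻ S, g (A * S * Aᵀ) ∂ν = ∫⁻ S, g S ∂ν)
    {g : Matrix (Fin q) (Fin q) ℝ → ℝ≥0∞} (hg : Measurable g) :
    (∫⁻ S, g S ∂ν) * ENNReal.ofReal (Real.pi ^ ((q : ℝ) * q / 2)) =
      (∫⁻ S, invWeight q S ∂ν) * ∫⁻ A, g (A * Aᵀ) ∂(haarGL q) := by
  have h1 : ∫⁻ S, ∫⁻ A, invWeight q S * g (A * S * Aᵀ) ∂(haarGL q) ∂ν =
      (∫⁻ S, invWeight q S ∂ν) * ∫⁻ A, g (A * Aᵀ) ∂(haarGL q) := by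
    rw [← lintegral_mul_const _ (measurable_invWeight q)]
    refine lintegral_congr_ae ?_
    filter_upwards [hν] with S hS
    rw [lintegral_const_mul _ (by fun_prop),
      lintegral_haarGL_conj hS hg]
  have h2 : ∫⁻ S, ∫⁻ A, invWeight q (A⁻¹ * S * (A⁻¹)ᵀ) * g S ∂(haarGL q) ∂ν =
      (∫⁻ S, g S ∂ν) * ENNReal.ofReal (Real.pi ^ ((q : ℝ) * q / 2)) := by
    rw [← lintegral_mul_const _ hg]
    refine lintegral_congr_ae ?_
    filter_upwards [hν] with S hS
    rw [lintegral_mul_const _ (by fun_prop),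
      lintegral_haarGL_invWeight hS, mul_comm]
  have h3 : ∫⁻ S, ∫⁻ A, invWeight q S * g (A * S * Aᵀ) ∂(haarGL q) ∂ν =
      ∫⁻ A, ∫⁻ S, invWeight q S * g (A * S * Aᵀ) ∂ν ∂(haarGL q) :=
    lintegral_lintegral_swap (by unfold Function.uncurry; fun_prop)
  have h4 : ∫⁻ S, ∫⁻ A, invWeight q (A⁻¹ * S * (A⁻¹)ᵀ) * g S ∂(haarGL q) ∂ν =
      ∫⁻ A, ∫⁻ S, invWeight q (A⁻¹ * S * (A⁻¹)ᵀ) * g S ∂ν ∂(haarGL q) :=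
    lintegral_lintegral_swap (by unfold Function.uncurry; fun_prop)
  rw [← h1, ← h2, h3, h4]
  refine lintegral_congr_ae ?_
  filter_upwards [ae_det_ne_zero_haarGL q] with A hA using
    (lintegral_invWeight_conj hinv hg hA).symm

theorem lintegral_invWeight_muP_ne_zero (q : ℕ) : ∫⁻ S, invWeight q S ∂(muP q) ≠ 0 := by
  rw [Ne, lintegral_eq_zero_iff (measurable_invWeight q)]
  intro h
  refine muP_ne_zero q (ae_eq_bot.mp (Filter.eventually_false_iff_eq_bot.mp ?_))
  filter_upwards [h, ae_posDef_muP q] with S h1 h2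
  have := det_psqrt_pos h2
  have h3 : 0 < (psqrt S).det⁻¹ ^ q * Real.exp (-(S⁻¹).trace) := by positivity
  have h1 : ENNReal.ofReal _ = 0 := h1
  exact absurd (ENNReal.ofReal_eq_zero.mp h1) (not_le.mpr h3)

theorem lintegral_muP_mul_eq_haarGL {g : Matrix (Fin q) (Fin q) ℝ → ℝ≥0∞} (hg : Measurable g) :
    (∫⁻ S, g S ∂(muP q)) * ENNReal.ofReal (Real.pi ^ ((q : ℝ) * q / 2)) =
      (∫⁻ S, invWeight q S ∂(muP q)) * ∫⁻ A, g (A * Aᵀ) ∂(haarGL q) :=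
  lintegral_mul_eq_haarGL (ae_posDef_muP q) (fun _ hA _ hg => lintegral_muP_conj hA hg) hg

theorem ofReal_pi_rpow_ne_zero (a : ℝ) : ENNReal.ofReal (Real.pi ^ a) ≠ 0 := by
  simpa using Real.rpow_pos_of_pos Real.pi_pos a

/-- Were it infinite, the preceding identity would force every measurable set to have measure `0` or
`∞`, impossible for a nonzero σ-finite measure. -/
theorem lintegral_invWeight_muP_ne_top (q : ℕ) : ∫⁻ S, invWeight q S ∂(muP q) ≠ ∞ := by
  intro h
  obtain ⟨t, ht, -, h0, h1⟩ := Measure.exists_subset_measure_lt_top (μ := muP q) (r := 0)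
    MeasurableSet.univ (by simpa [pos_iff_ne_zero] using muP_ne_zero q)
  have := lintegral_muP_mul_eq_haarGL (q := q) (measurable_one.indicator ht)
  rw [lintegral_indicator_one ht, h] at this
  by_cases h2 : ∫⁻ A, t.indicator (1 : Matrix (Fin q) (Fin q) ℝ → ℝ≥0∞) (A * Aᵀ) ∂(haarGL q) = 0
  · rw [h2, mul_zero, mul_eq_zero] at this
    exact this.elim h0.ne' (ofReal_pi_rpow_ne_zero _)
  · rw [ENNReal.top_mul h2] at this
    exact ENNReal.mul_ne_top h1.ne ENNReal.ofReal_ne_top this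

/-- An invariant measure on the positive definite matrices is a multiple of `muP`. -/
theorem exists_lintegral_eq_mul_muP [SFinite ν] (hν : ∀ᵐ S ∂ν, S.PosDef)
    (hinv : ∀ A : Matrix (Fin q) (Fin q) ℝ, A.det ≠ 0 →
      ∀ g : Matrix (Fin q) (Fin q) ℝ → ℝ≥0∞, Measurable g →
      ∫⁻ S, g (A * S * Aᵀ) ∂ν = ∫⁻ S, g S ∂ν) :
    ∃ c : ℝ≥0∞, ∀ g : Matrix (Fin q) (Fin q) ℝ → ℝ≥0∞, Measurable g →
      ∫⁻ S, g S ∂ν = c * ∫⁻ S, g S ∂(muP q) := by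
  refine ⟨(∫⁻ S, invWeight q S ∂ν) / ∫⁻ S, invWeight q S ∂(muP q), fun g hg => ?_⟩
  have h1 := lintegral_mul_eq_haarGL hν hinv hg
  have h2 := lintegral_muP_mul_eq_haarGL hg
  have hK := ofReal_pi_rpow_ne_zero ((q : ℝ) * q / 2)
  have hK' : ENNReal.ofReal (Real.pi ^ ((q : ℝ) * q / 2)) ≠ ∞ := ENNReal.ofReal_ne_top
  have ha := lintegral_invWeight_muP_ne_zero q
  have hb := lintegral_invWeight_muP_ne_top q
  refine (ENNReal.mul_left_inj hK hK').mp ?_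
  rw [mul_assoc, h2, h1, ← mul_assoc, ENNReal.div_mul_cancel ha hb]

/-! ### Invariance of `muP` under inversion -/

theorem det_inv_ne_zero {q : ℕ} {A : Matrix (Fin q) (Fin q) ℝ} (hA : A.det ≠ 0) :
    A⁻¹.det ≠ 0 := by
  rw [det_nonsing_inv, Ring.inverse_eq_inv']
  exact inv_ne_zero hA

/-- Inversion intertwines congruence by `A` with congruence by its inverse transpose, so the image
of `muP` is invariant and equals `c • muP`. Inverting twice gives `c² = 1`, tested on `invWeight`
because its integral is positive and finite. -/
theorem lintegral_muP_inv {q : ℕ} {g : Matrix (Fin q) (Fin q) ℝ → ℝ≥0∞} (hg : Measurable g) :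
    ∫⁻ S, g S⁻¹ ∂(muP q) = ∫⁻ S, g S ∂(muP q) := by
  have hm : Measurable fun S : Matrix (Fin q) (Fin q) ℝ => S⁻¹ := by fun_prop
  have hl {g : Matrix (Fin q) (Fin q) ℝ → ℝ≥0∞} (hg : Measurable g) :
      ∫⁻ S, g S ∂((muP q).map fun S => S⁻¹) = ∫⁻ S, g S⁻¹ ∂(muP q) := lintegral_map hg hm
  obtain ⟨c, hc⟩ := exists_lintegral_eq_mul_muP (ν := (muP q).map fun S => S⁻¹)
    (by
      rw [ae_map_iff hm.aemeasurable measurableSet_posDef]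
      filter_upwards [ae_posDef_muP q] with S hS using hS.inv)
    (by
      intro A hA g hg
      rw [hl (g := fun S => g (A * S * Aᵀ)) (by fun_prop), hl hg,
        ← lintegral_muP_conj (A := (A⁻¹)ᵀ) (by rw [det_transpose]; exact det_inv_ne_zero hA)
          (g := fun S => g S⁻¹) (by fun_prop)]
      refine lintegral_congr fun S => ?_
      congr 1
      rw [transpose_transpose, Matrix.mul_inv_rev, Matrix.mul_inv_rev,
        nonsing_inv_nonsing_inv _ hA.isUnit, ← transpose_nonsing_inv,
        nonsing_inv_nonsing_inv _ hA.isUnit, Matrix.mul_assoc])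
  have hc1 : c = 1 := by
    have h1 := hc _ (measurable_invWeight q)
    have h2 := hc (fun S => invWeight q S⁻¹) (by fun_prop)
    rw [hl (measurable_invWeight q)] at h1
    rw [hl (g := fun S => invWeight q S⁻¹) (by fun_prop), h1, ← mul_assoc,
      lintegral_congr_ae (g := invWeight q)] at h2
    · have h3 : 1 ^ 2 = c ^ 2 := by
        rw [one_pow, sq]
        refine (ENNReal.mul_left_inj (lintegral_invWeight_muP_ne_zero q)
          (lintegral_invWeight_muP_ne_top q)).mp ?_
        rw [one_mul]
        exact h2
      exact ((ENNReal.pow_right_strictMono two_ne_zero).injective h3).symm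
    · filter_upwards [ae_posDef_muP q] with S hS
      rw [nonsing_inv_nonsing_inv _ hS.det_pos.ne'.isUnit]
  rw [← hl hg, hc g hg, hc1, one_mul]

/-! ### The law of the Gram matrix and the multivariate Gamma function -/

/-- The multivariate Gamma integral with values in `[0, ∞]`. -/
noncomputable def lgamma (q : ℕ) (a : ℝ) : ℝ≥0∞ :=
  ∫⁻ S, ENNReal.ofReal (Real.exp (-S.trace) * S.det ^ a) ∂(muP q)

/-- The weight `det (XᵀX) ^ (-p/2)` makes Lebesgue measure invariant under `X ↦ X Aᵀ`, so its image
under the Gram map is invariant under congruence, and uniqueness applies. -/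
theorem exists_lintegral_gram {p q : ℕ} (hqp : q ≤ p) :
    ∃ c : ℝ≥0∞, ∀ g : Matrix (Fin q) (Fin q) ℝ → ℝ≥0∞, Measurable g →
      ∫⁻ X, g (Xᵀ * X) ∂(lebM p q) =
        c * ∫⁻ S, ENNReal.ofReal (S.det ^ ((p : ℝ) / 2)) * g S ∂(muP q) := by
  set d : Matrix (Fin p) (Fin q) ℝ → ℝ≥0∞ := fun X =>
    ENNReal.ofReal ((Xᵀ * X).det ^ (-((p : ℝ) / 2))) with hd
  have hdm : Measurable d := by fun_prop
  set ν := ((lebM p q).withDensity d).map fun X => Xᵀ * X with hν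
  have hm : Measurable fun X : Matrix (Fin p) (Fin q) ℝ => Xᵀ * X := by fun_prop
  have : SigmaFinite ((lebM p q).withDensity d) :=
    SigmaFinite.withDensity_of_ne_top (by simp [d])
  have hl {g : Matrix (Fin q) (Fin q) ℝ → ℝ≥0∞} (hg : Measurable g) :
      ∫⁻ S, g S ∂ν = ∫⁻ X, d X * g (Xᵀ * X) ∂(lebM p q) := by
    rw [hν, lintegral_map hg hm, lintegral_withDensity_eq_lintegral_mul _ hdm (by fun_prop)]
    rfl
  obtain ⟨c, hc⟩ := exists_lintegral_eq_mul_muP (ν := ν)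
    (by
      rw [hν, ae_map_iff hm.aemeasurable measurableSet_posDef]
      exact (withDensity_absolutelyContinuous _ _).ae_le (ae_posDef_transpose_mul_self hqp))
    (by
      intro A hA g hg
      have hA' : 0 < |A.det| := abs_pos.mpr hA
      rw [hl (g := fun S => g (A * S * Aᵀ)) (by fun_prop), hl hg,
        ← lintegral_lebM_mul (B := 1) (D := Aᵀ) (by simp) (by rwa [det_transpose])
          (h := fun X => d X * g (Xᵀ * X)) (by fun_prop),
        ← lintegral_const_mul' _ _ ENNReal.ofReal_ne_top]
      refine lintegral_congr_ae ?_
      filter_upwards [ae_posDef_transpose_mul_self hqp] with X hX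
      have h1 : ((1 : Matrix (Fin p) (Fin p) ℝ) * X * Aᵀ)ᵀ * ((1 : Matrix (Fin p) (Fin p) ℝ) * X * Aᵀ) =
          A * (Xᵀ * X) * Aᵀ := by
        simp only [Matrix.one_mul, transpose_mul, transpose_transpose, Matrix.mul_assoc]
      have h2 : (A * (Xᵀ * X) * Aᵀ).det = |A.det| ^ 2 * (Xᵀ * X).det := by
        rw [det_mul, det_mul, det_transpose, sq_abs]
        ring
      simp only [hd, h1]
      rw [← mul_assoc, ← ENNReal.ofReal_mul (by positivity), h2]
      congr 2
      rw [Real.mul_rpow (by positivity) hX.det_pos.le, ← mul_assoc, ← Real.rpow_natCast _ 2,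
        ← Real.rpow_mul hA'.le, det_one, abs_one, one_pow, one_mul, det_transpose,
        ← Real.rpow_natCast _ p, ← Real.rpow_add hA']
      push_cast
      rw [show (p : ℝ) + 2 * (-((p : ℝ) / 2)) = 0 by ring, Real.rpow_zero, one_mul])
  refine ⟨c, fun g hg => ?_⟩
  rw [← hc _ (by fun_prop), hl (by fun_prop)]
  refine lintegral_congr_ae ?_
  filter_upwards [ae_posDef_transpose_mul_self hqp] with X hX
  simp only [hd]
  rw [← mul_assoc, ← ENNReal.ofReal_mul (Real.rpow_nonneg hX.det_pos.le _),
    ← Real.rpow_add hX.det_pos, neg_add_cancel, Real.rpow_zero, ENNReal.ofReal_one, one_mul]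

/-! ### The Gamma constant: value and finiteness -/

theorem lgamma_ne_zero (q : ℕ) (a : ℝ) : lgamma q a ≠ 0 := by
  rw [lgamma, Ne, lintegral_eq_zero_iff (by fun_prop)]
  intro h
  refine muP_ne_zero q (ae_eq_bot.mp (Filter.eventually_false_iff_eq_bot.mp ?_))
  filter_upwards [h, ae_posDef_muP q] with S h1 h2
  have h3 := mul_pos (Real.exp_pos (-S.trace)) (Real.rpow_pos_of_pos h2.det_pos a)
  have h1 : ENNReal.ofReal _ = 0 := h1
  exact absurd (ENNReal.ofReal_eq_zero.mp h1) (not_le.mpr h3)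

/-- Testing on `exp (-tr S)` pins down the constant: one side becomes a Gaussian integral, the other
a Gamma integral. -/
theorem exists_lgamma {p q : ℕ} (hqp : q ≤ p) :
    ∃ c : ℝ≥0∞, c * lgamma q ((p : ℝ) / 2) = ENNReal.ofReal (Real.pi ^ ((p : ℝ) * q / 2)) ∧
    ∀ g : Matrix (Fin q) (Fin q) ℝ → ℝ≥0∞, Measurable g →
      ∫⁻ X, g (Xᵀ * X) ∂(lebM p q) =
        c * ∫⁻ S, ENNReal.ofReal (S.det ^ ((p : ℝ) / 2)) * g S ∂(muP q) := by
  obtain ⟨c, hc⟩ := exists_lintegral_gram hqp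
  refine ⟨c, ?_, hc⟩
  rw [← lintegral_exp_neg_trace, hc (fun S => ENNReal.ofReal (Real.exp (-S.trace))) (by fun_prop),
    lgamma]
  congr 1
  refine lintegral_congr fun S => ?_
  rw [ENNReal.ofReal_mul (Real.exp_pos _).le, mul_comm]

/-- Finiteness comes for free: a product with an infinite factor is `0` or `∞`, never the positive
finite power of `π`. -/
theorem lgamma_half_ne_top {p q : ℕ} (hqp : q ≤ p) : lgamma q ((p : ℝ) / 2) ≠ ∞ := by
  obtain ⟨c, hc, -⟩ := exists_lgamma hqp
  intro h
  rw [h] at hc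
  by_cases h0 : c = 0
  · rw [h0, zero_mul] at hc
    exact ofReal_pi_rpow_ne_zero _ hc.symm
  · rw [ENNReal.mul_top h0] at hc
    exact ENNReal.ofReal_ne_top hc.symm

theorem lgamma_ne_top {p q : ℕ} (hqp : q ≤ p) : lgamma q (p : ℝ) ≠ ∞ := by
  have h := lgamma_half_ne_top (q := q) (p := 2 * p) (by omega)
  rwa [show (((2 * p : ℕ) : ℝ)) / 2 = p by push_cast; ring] at h

/-- The law of the Gram matrix `XᵀX` under the Lebesgue measure. -/
theorem lintegral_gram {p q : ℕ} (hqp : q ≤ p) {g : Matrix (Fin q) (Fin q) ℝ → ℝ≥0∞}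
    (hg : Measurable g) :
    lgamma q ((p : ℝ) / 2) * ∫⁻ X, g (Xᵀ * X) ∂(lebM p q) =
      ENNReal.ofReal (Real.pi ^ ((p : ℝ) * q / 2)) *
        ∫⁻ S, ENNReal.ofReal (S.det ^ ((p : ℝ) / 2)) * g S ∂(muP q) := by
  obtain ⟨c, hc, h⟩ := exists_lgamma hqp
  rw [h g hg, ← hc]
  ring

theorem multiGamma_eq_toReal (q : ℕ) (a : ℝ) : multiGamma q a = (lgamma q a).toReal := by
  rw [multiGamma, integral_eq_lintegral_of_nonneg_ae, lgamma]
  · filter_upwards [ae_posDef_muP q] with S hS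
    exact mul_nonneg (Real.exp_pos _).le (Real.rpow_nonneg hS.det_pos.le _)
  · exact Measurable.aestronglyMeasurable (by fun_prop)

theorem multiGamma_pos {q : ℕ} {a : ℝ} (h : lgamma q a ≠ ∞) : 0 < multiGamma q a := by
  rw [multiGamma_eq_toReal]
  exact ENNReal.toReal_pos (lgamma_ne_zero q a) h

theorem ofReal_multiGamma {q : ℕ} {a : ℝ} (h : lgamma q a ≠ ∞) :
    ENNReal.ofReal (multiGamma q a) = lgamma q a := by
  rw [multiGamma_eq_toReal, ENNReal.ofReal_toReal h]

theorem lintegral_exp_neg_trace_mul {q : ℕ} (a : ℝ) {T : Matrix (Fin q) (Fin q) ℝ}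
    (hT : T.PosDef) :
    ∫⁻ S, ENNReal.ofReal (Real.exp (-(T * S).trace / 2) * S.det ^ a) ∂(muP q) =
      ENNReal.ofReal (2 ^ (a * q) * T.det ^ (-a)) * lgamma q a := by
  have hs : √(2 : ℝ) ≠ 0 := by positivity
  have hti : ((psqrt T)⁻¹)ᵀ = (psqrt T)⁻¹ := by rw [transpose_nonsing_inv, psqrt_transpose hT]
  have hdi : (psqrt T)⁻¹.det = (psqrt T).det⁻¹ := by
    rw [det_nonsing_inv, Ring.inverse_eq_inv']
  -- Congruence by `√2 T^{-1/2}` turns `tr (T S) / 2` into `tr S`.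
  rw [← lintegral_muP_conj (A := √2 • (psqrt T)⁻¹)
    (by
      rw [det_smul]
      exact mul_ne_zero (pow_ne_zero _ hs) (det_inv_ne_zero (det_psqrt_pos hT).ne'))
    (by fun_prop), lgamma, ← lintegral_const_mul' _ _ ENNReal.ofReal_ne_top]
  refine lintegral_congr_ae ?_
  filter_upwards [ae_posDef_muP q] with S hS
  have h1 : √2 • (psqrt T)⁻¹ * S * (√2 • (psqrt T)⁻¹)ᵀ =
      (2 : ℝ) • ((psqrt T)⁻¹ * S * (psqrt T)⁻¹) := by
    rw [transpose_smul, hti, Matrix.smul_mul, Matrix.smul_mul, Matrix.mul_smul, smul_smul,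
      Real.mul_self_sqrt zero_le_two]
  have h2 : (T * ((2 : ℝ) • ((psqrt T)⁻¹ * S * (psqrt T)⁻¹))).trace / 2 = S.trace := by
    rw [Matrix.mul_smul, trace_smul, smul_eq_mul, mul_div_cancel_left₀ _ two_ne_zero]
    have h : T * ((psqrt T)⁻¹ * S * (psqrt T)⁻¹) =
        psqrt T * (psqrt T * (psqrt T)⁻¹) * S * (psqrt T)⁻¹ := by
      nth_rw 1 [← psqrt_mul_self hT]
      simp only [Matrix.mul_assoc]
    rw [h, psqrt_mul_inv hT, Matrix.mul_one, trace_mul_comm, ← Matrix.mul_assoc,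
      psqrt_inv_mul hT, Matrix.one_mul]
  have h3 : ((2 : ℝ) • ((psqrt T)⁻¹ * S * (psqrt T)⁻¹)).det = 2 ^ q * T.det⁻¹ * S.det := by
    rw [det_smul, det_mul, det_mul, hdi, ← det_psqrt_sq hT, Fintype.card_fin, sq, mul_inv]
    ring
  have hT0 := hT.det_pos
  have hS0 := hS.det_pos
  rw [h1, neg_div, h2, h3, ← ENNReal.ofReal_mul (by positivity)]
  congr 1
  rw [Real.mul_rpow (by positivity) hS0.le, Real.mul_rpow (by positivity) (by positivity),
    ← Real.rpow_natCast 2 q, ← Real.rpow_mul zero_le_two, Real.inv_rpow hT0.le,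
    ← Real.rpow_neg hT0.le, mul_comm (q : ℝ) a]
  ring

/-! ### The uniform distribution on the orthogonal group -/

section Orthogonal

variable {p q : ℕ}

instance secondCountableTopology_unitaryGroup (p : ℕ) :
    SecondCountableTopology (unitaryGroup (Fin p) ℝ) :=
  TopologicalSpace.Subtype.secondCountableTopology _

instance isHaarMeasure_uniformO (p : ℕ) : (uniformO p).IsHaarMeasure := by
  unfold uniformO; infer_instance

instance isProbabilityMeasure_uniformO (p : ℕ) : IsProbabilityMeasure (uniformO p) :=
  ⟨by
    rw [uniformO, ← TopologicalSpace.PositiveCompacts.coe_top]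
    exact Measure.haarMeasure_self⟩

/-- Integrate `h (R⁻¹ T)` in both orders: left invariance makes either inner integral constant, and
the total mass is one. -/
theorem lintegral_uniformO_inv {h : unitaryGroup (Fin p) ℝ → ℝ≥0∞} (hh : Measurable h) :
    ∫⁻ R, h R⁻¹ ∂(uniformO p) = ∫⁻ R, h R ∂(uniformO p) := by
  have h1 (T : unitaryGroup (Fin p) ℝ) :
      ∫⁻ R, h (R⁻¹ * T) ∂(uniformO p) = ∫⁻ R, h R⁻¹ ∂(uniformO p) := by
    rw [← lintegral_mul_left_eq_self (μ := uniformO p) (fun R => h R⁻¹) T⁻¹]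
    simp
  have h2 (R : unitaryGroup (Fin p) ℝ) :
      ∫⁻ T, h (R⁻¹ * T) ∂(uniformO p) = ∫⁻ T, h T ∂(uniformO p) :=
    lintegral_mul_left_eq_self h R⁻¹
  have hm : Measurable fun z : unitaryGroup (Fin p) ℝ × unitaryGroup (Fin p) ℝ =>
      h (z.2⁻¹ * z.1) := hh.comp (Continuous.measurable (by fun_prop))
  have h3 : ∫⁻ T, ∫⁻ R, h (R⁻¹ * T) ∂(uniformO p) ∂(uniformO p) =
      ∫⁻ R, ∫⁻ T, h (R⁻¹ * T) ∂(uniformO p) ∂(uniformO p) :=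
    lintegral_lintegral_swap hm.aemeasurable
  simpa [h1, h2] using h3

theorem lintegral_uniformO_mul_right {h : unitaryGroup (Fin p) ℝ → ℝ≥0∞} (hh : Measurable h)
    (T : unitaryGroup (Fin p) ℝ) :
    ∫⁻ R, h (R * T) ∂(uniformO p) = ∫⁻ R, h R ∂(uniformO p) := by
  rw [← lintegral_uniformO_inv (h := fun R => h (R * T)) (by fun_prop),
    ← lintegral_uniformO_inv hh,
    ← lintegral_mul_left_eq_self (μ := uniformO p) (fun R => h R⁻¹) T⁻¹]
  simp

/-- The first `q` columns of the identity matrix. -/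
def firstCols (hqp : q ≤ p) : Matrix (Fin p) (Fin q) ℝ :=
  (1 : Matrix (Fin p) (Fin p) ℝ).submatrix id (Fin.castLE hqp)

theorem mul_firstCols (hqp : q ≤ p) (A : Matrix (Fin p) (Fin p) ℝ) :
    A * firstCols hqp = A.submatrix id (Fin.castLE hqp) := by
  ext i j
  simp [firstCols, mul_apply, one_apply]

theorem transpose_mul_firstCols {m : ℕ} (hqp : q ≤ p) (A : Matrix (Fin p) (Fin m) ℝ) :
    (firstCols hqp)ᵀ * A = A.submatrix (Fin.castLE hqp) id := by
  ext i j
  simp [firstCols, mul_apply, one_apply]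

theorem lintegral_uniformStiefel (hqp : q ≤ p) {h : Matrix (Fin p) (Fin q) ℝ → ℝ≥0∞}
    (hh : Measurable h) :
    ∫⁻ O, h O ∂(uniformStiefel hqp) =
      ∫⁻ R : unitaryGroup (Fin p) ℝ, h (R.1 * firstCols hqp) ∂(uniformO p) := by
  simp only [mul_firstCols]
  exact lintegral_map hh (by fun_prop)

instance isProbabilityMeasure_uniformStiefel (hqp : q ≤ p) :
    IsProbabilityMeasure (uniformStiefel hqp) :=
  Measure.isProbabilityMeasure_map (Measurable.aemeasurable (by fun_prop))

/-- A matrix with orthonormal columns extends to an orthogonal matrix. -/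
theorem exists_mul_firstCols_eq (hqp : q ≤ p) {O : Matrix (Fin p) (Fin q) ℝ} (hO : Oᵀ * O = 1) :
    ∃ R : unitaryGroup (Fin p) ℝ, R.1 * firstCols hqp = O := by
  set v : Fin p → EuclideanSpace ℝ (Fin p) := fun k =>
    if hk : k.1 < q then WithLp.toLp 2 fun i => O i ⟨k, hk⟩ else 0 with hv
  have hcol (k : Fin q) : v (Fin.castLE hqp k) = WithLp.toLp 2 fun i => O i k := by simp [hv]
  have hon : Orthonormal ℝ ((Set.range (Fin.castLE hqp)).domRestrict v) := by
    rw [orthonormal_iff_ite]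
    rintro ⟨_, k, rfl⟩ ⟨_, l, rfl⟩
    have := congrFun (congrFun hO l) k
    simp only [mul_apply, transpose_apply, one_apply] at this
    change inner ℝ (v (Fin.castLE hqp k)) (v (Fin.castLE hqp l)) = _
    simp only [hcol, PiLp.inner_apply, RCLike.inner_apply, conj_trivial, this]
    by_cases hkl : k = l
    · simp [hkl]
    · simp [Ne.symm hkl, Subtype.ext_iff, hkl]
  obtain ⟨b, hb⟩ := hon.exists_orthonormalBasis_extension_of_card_eq (by simp)
  have hR : (Matrix.of fun i k => b k i : Matrix (Fin p) (Fin p) ℝ) ∈ unitaryGroup (Fin p) ℝ := by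
    rw [mem_unitaryGroup_iff']
    ext k l
    have := orthonormal_iff_ite.mp b.orthonormal l k
    simp only [PiLp.inner_apply, RCLike.inner_apply, conj_trivial] at this
    simp [mul_apply, one_apply, this, eq_comm]
  refine ⟨⟨_, hR⟩, ?_⟩
  rw [mul_firstCols]
  ext i k
  have h1 : b (Fin.castLE hqp k) = v (Fin.castLE hqp k) := hb _ ⟨k, rfl⟩
  simp [h1, hcol]

theorem abs_det_orthogonal (R : unitaryGroup (Fin p) ℝ) : |R.1.det| = 1 := by
  have h := congrArg det (mem_unitaryGroup_iff.mp R.2)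
  rw [det_mul, star_eq_conjTranspose, conjTranspose_eq_transpose_of_trivial, det_transpose,
    det_one, ← sq] at h
  simpa using (sq_eq_sq_iff_abs_eq_abs R.1.det 1).mp (by rw [h, one_pow])

/-- The orthonormal factor of the polar decomposition of `X` extends to an orthogonal matrix, which
right invariance absorbs; only the Gram matrix of `X` survives. -/
theorem lintegral_uniformO_mul_of_posDef (hqp : q ≤ p) {h : Matrix (Fin p) (Fin q) ℝ → ℝ≥0∞}
    (hh : Measurable h) {X : Matrix (Fin p) (Fin q) ℝ} (hX : (Xᵀ * X).PosDef) :
    ∫⁻ R : unitaryGroup (Fin p) ℝ, h (R.1 * X) ∂(uniformO p) =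
      ∫⁻ O, h (O * psqrt (Xᵀ * X)) ∂(uniformStiefel hqp) := by
  set s := psqrt (Xᵀ * X) with hs
  have hsi : (s⁻¹)ᵀ = s⁻¹ := by rw [transpose_nonsing_inv, psqrt_transpose hX]
  obtain ⟨T, hT⟩ := exists_mul_firstCols_eq hqp (O := X * s⁻¹) (by
    rw [transpose_mul, hsi, Matrix.mul_assoc, ← Matrix.mul_assoc Xᵀ, ← psqrt_mul_self hX, ← hs,
      Matrix.mul_assoc, psqrt_mul_inv hX, Matrix.mul_one, psqrt_inv_mul hX])
  have hXs : X = T.1 * firstCols hqp * s := by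
    rw [hT, Matrix.mul_assoc, psqrt_inv_mul hX, Matrix.mul_one]
  rw [lintegral_uniformStiefel hqp (h := fun O => h (O * s)) (by fun_prop),
    ← lintegral_uniformO_mul_right (h := fun R => h (R.1 * firstCols hqp * s)) (by fun_prop) T]
  refine lintegral_congr fun R => ?_
  congr 1
  conv_lhs => rw [hXs]
  simp only [Submonoid.coe_mul, Matrix.mul_assoc]

/-- Polar decomposition of the Lebesgue measure on matrices. -/
theorem lintegral_polar (hqp : q ≤ p) {h : Matrix (Fin p) (Fin q) ℝ → ℝ≥0∞} (hh : Measurable h) :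
    lgamma q ((p : ℝ) / 2) * ∫⁻ X, h X ∂(lebM p q) =
      ENNReal.ofReal (Real.pi ^ ((p : ℝ) * q / 2)) *
        ∫⁻ S, ENNReal.ofReal (S.det ^ ((p : ℝ) / 2)) *
          ∫⁻ O, h (O * psqrt S) ∂(uniformStiefel hqp) ∂(muP q) := by
  have hm : Measurable fun S => ∫⁻ O, h (O * psqrt S) ∂(uniformStiefel hqp) :=
    Measurable.lintegral_prod_right' (f := fun z : Matrix (Fin q) (Fin q) ℝ ×
      Matrix (Fin p) (Fin q) ℝ => h (z.2 * psqrt z.1)) (by fun_prop)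
  refine Eq.trans (congrArg _ ?_) (lintegral_gram hqp hm)
  have h1 (R : unitaryGroup (Fin p) ℝ) :
      ∫⁻ X, h (R.1 * X) ∂(lebM p q) = ∫⁻ X, h X ∂(lebM p q) := by
    have hR := abs_det_orthogonal R
    have := lintegral_lebM_mul (B := R.1) (D := 1) (by
      intro h0; rw [h0] at hR; simp at hR) (by simp) hh
    simpa [hR] using this
  -- Lebesgue measure is invariant under rotations, so averaging over them changes nothing; after
  -- exchanging the integrals the integrand depends on `XᵀX` only.
  calc ∫⁻ X, h X ∂(lebM p q)
      = ∫⁻ R : unitaryGroup (Fin p) ℝ, ∫⁻ X, h (R.1 * X) ∂(lebM p q) ∂(uniformO p) := by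
        simp [h1]
    _ = ∫⁻ X, ∫⁻ R : unitaryGroup (Fin p) ℝ, h (R.1 * X) ∂(uniformO p) ∂(lebM p q) :=
        lintegral_lintegral_swap (by unfold Function.uncurry; fun_prop)
    _ = _ := by
        refine lintegral_congr_ae ?_
        filter_upwards [ae_posDef_transpose_mul_self hqp] with X hX
        exact lintegral_uniformO_mul_of_posDef hqp hh hX

end Orthogonal

/-! ### The proposal kernel -/

section Proposal

variable {p q : ℕ}

/-- The density of the centred matrix-normal distribution. -/
noncomputable def normalDensity (U : Matrix (Fin p) (Fin p) ℝ) (V : Matrix (Fin q) (Fin q) ℝ)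
    (X : Matrix (Fin p) (Fin q) ℝ) : ℝ :=
  Real.exp (-(V⁻¹ * Xᵀ * U⁻¹ * X).trace / 2) /
    ((2 * Real.pi) ^ ((p : ℝ) * q / 2) * U.det ^ ((q : ℝ) / 2) * V.det ^ ((p : ℝ) / 2))

/-- The density of the inverse Wishart distribution with `p` degrees of freedom. -/
noncomputable def invWishartDensity (p : ℕ) (T S : Matrix (Fin q) (Fin q) ℝ) : ℝ :=
  T.det ^ ((p : ℝ) / 2) * Real.exp (-(T * S⁻¹).trace / 2) /
    ((2 : ℝ) ^ ((p : ℝ) * q / 2) * S.det ^ ((p : ℝ) / 2) * multiGamma q ((p : ℝ) / 2))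

@[fun_prop]
theorem measurable_normalDensity {α : Type*} [MeasurableSpace α] (U : Matrix (Fin p) (Fin p) ℝ)
    {f : α → Matrix (Fin q) (Fin q) ℝ} {g : α → Matrix (Fin p) (Fin q) ℝ}
    (hf : Measurable f) (hg : Measurable g) :
    Measurable fun a => normalDensity U (f a) (g a) := by
  unfold normalDensity
  fun_prop

@[fun_prop]
theorem measurable_invWishartDensity {α : Type*} [MeasurableSpace α]
    (T : Matrix (Fin q) (Fin q) ℝ) {f : α → Matrix (Fin q) (Fin q) ℝ} (hf : Measurable f) :
    Measurable fun a => invWishartDensity p T (f a) := by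
  unfold invWishartDensity
  fun_prop

theorem matrixNormal_zero_eq (U : Matrix (Fin p) (Fin p) ℝ) (V : Matrix (Fin q) (Fin q) ℝ) :
    matrixNormal 0 U V = (lebM p q).withDensity fun X => ENNReal.ofReal (normalDensity U V X) := by
  simp only [matrixNormal, sub_zero, normalDensity]

theorem inverseWishart_eq (T : Matrix (Fin q) (Fin q) ℝ) :
    inverseWishart (p : ℝ) T =
      (muP q).withDensity fun S => ENNReal.ofReal (invWishartDensity p T S) := rfl

theorem lintegral_matrixNormal (U : Matrix (Fin p) (Fin p) ℝ) (V : Matrix (Fin q) (Fin q) ℝ)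
    {h : Matrix (Fin p) (Fin q) ℝ → ℝ≥0∞} (hh : Measurable h) :
    ∫⁻ X, h X ∂(matrixNormal 0 U V) =
      ∫⁻ X, ENNReal.ofReal (normalDensity U V X) * h X ∂(lebM p q) := by
  rw [matrixNormal_zero_eq]
  exact lintegral_withDensity_eq_lintegral_mul _ (by fun_prop) hh

theorem lintegral_inverseWishart (T : Matrix (Fin q) (Fin q) ℝ)
    {h : Matrix (Fin q) (Fin q) ℝ → ℝ≥0∞} (hh : Measurable h) :
    ∫⁻ S, h S ∂(inverseWishart (p : ℝ) T) =
      ∫⁻ S, ENNReal.ofReal (invWishartDensity p T S) * h S ∂(muP q) := by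
  rw [inverseWishart_eq]
  exact lintegral_withDensity_eq_lintegral_mul _ (by fun_prop) hh

theorem measurable_matrixNormal (U : Matrix (Fin p) (Fin p) ℝ) :
    Measurable fun V : Matrix (Fin q) (Fin q) ℝ =>
      (matrixNormal 0 U V : Measure (Matrix (Fin p) (Fin q) ℝ)) := by
  refine Measure.measurable_of_measurable_coe _ fun s hs => ?_
  have h (V : Matrix (Fin q) (Fin q) ℝ) : matrixNormal 0 U V s =
      ∫⁻ X, ENNReal.ofReal (normalDensity U V X) * s.indicator 1 X ∂(lebM p q) := by
    rw [← lintegral_matrixNormal U V (measurable_one.indicator hs), lintegral_indicator_one hs]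
  simp only [h]
  exact Measurable.lintegral_prod_right' (f := fun z : Matrix (Fin q) (Fin q) ℝ ×
      Matrix (Fin p) (Fin q) ℝ => ENNReal.ofReal (normalDensity U z.1 z.2) * s.indicator 1 z.2)
    (Measurable.mul (by fun_prop) ((measurable_one.indicator hs).comp measurable_snd))

theorem isProbabilityMeasure_matrixNormal {U : Matrix (Fin p) (Fin p) ℝ} (hU : U.PosDef)
    {V : Matrix (Fin q) (Fin q) ℝ} (hV : V.PosDef) :
    IsProbabilityMeasure (matrixNormal 0 U V : Measure (Matrix (Fin p) (Fin q) ℝ)) := by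
  have hU0 := hU.det_pos
  have hV0 := hV.det_pos
  have hs2 : (√2 : ℝ) ≠ 0 := by positivity
  -- The substitution `X = U^{1/2} Z (√2 V^{1/2})` reduces to the standard Gaussian integral.
  have hUV (Z : Matrix (Fin p) (Fin q) ℝ) :
      (V⁻¹ * (psqrt U * Z * (√2 • psqrt V))ᵀ * U⁻¹ * (psqrt U * Z * (√2 • psqrt V))).trace / 2 =
        (Zᵀ * Z).trace := by
    have h1 : V⁻¹ * (psqrt U * Z * (√2 • psqrt V))ᵀ * U⁻¹ * (psqrt U * Z * (√2 • psqrt V)) =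
        (2 : ℝ) • (V⁻¹ * psqrt V * Zᵀ * (psqrt U * U⁻¹ * psqrt U) * Z * psqrt V) := by
      rw [transpose_mul, transpose_mul, transpose_smul, psqrt_transpose hU, psqrt_transpose hV]
      simp only [Matrix.mul_smul, Matrix.smul_mul, smul_smul, Real.mul_self_sqrt zero_le_two,
        Matrix.mul_assoc]
    have h2 : psqrt U * U⁻¹ * psqrt U = 1 := by
      nth_rw 2 [← psqrt_mul_self hU]
      rw [Matrix.mul_inv_rev, ← Matrix.mul_assoc, psqrt_mul_inv hU, Matrix.one_mul,
        psqrt_inv_mul hU]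
    have h3 : V⁻¹ * psqrt V = (psqrt V)⁻¹ := by
      nth_rw 1 [← psqrt_mul_self hV]
      rw [Matrix.mul_inv_rev, Matrix.mul_assoc, psqrt_inv_mul hV, Matrix.mul_one]
    rw [h1, h2, h3, Matrix.mul_one, trace_smul, smul_eq_mul, mul_div_cancel_left₀ _ two_ne_zero,
      trace_mul_comm, ← Matrix.mul_assoc, ← Matrix.mul_assoc, psqrt_mul_inv hV, Matrix.one_mul]
  constructor
  rw [← lintegral_one, lintegral_matrixNormal U V (h := fun _ => 1) measurable_const,
    ← lintegral_lebM_mul (B := psqrt U) (D := √2 • psqrt V) (det_psqrt_pos hU).ne'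
      (by rw [det_smul]; exact mul_ne_zero (pow_ne_zero _ hs2) (det_psqrt_pos hV).ne')
      (by fun_prop)]
  simp only [mul_one, normalDensity, neg_div, hUV]
  simp only [div_eq_inv_mul (Real.exp _)]
  simp only [ENNReal.ofReal_mul (inv_nonneg.mpr (by positivity :
    0 ≤ (2 * Real.pi) ^ ((p : ℝ) * q / 2) * U.det ^ ((q : ℝ) / 2) * V.det ^ ((p : ℝ) / 2)))]
  rw [lintegral_const_mul' _ _ ENNReal.ofReal_ne_top, lintegral_exp_neg_trace,
    ← ENNReal.ofReal_mul (by positivity), ← ENNReal.ofReal_mul (by positivity),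
    ← ENNReal.ofReal_one]
  congr 1
  rw [abs_of_pos (det_psqrt_pos hU), det_smul, Fintype.card_fin, abs_mul,
    abs_of_pos (det_psqrt_pos hV), mul_pow, det_psqrt_pow hU, det_psqrt_pow hV,
    abs_of_pos (by positivity), ← pow_mul, Real.sqrt_eq_rpow, ← Real.rpow_natCast,
    ← Real.rpow_mul zero_le_two, Real.mul_rpow zero_le_two Real.pi_pos.le]
  have h2 : (2 : ℝ) ^ (1 / 2 * ((q * p : ℕ) : ℝ)) = 2 ^ ((p : ℝ) * q / 2) := by
    congr 1; push_cast; ring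
  rw [h2]
  field_simp

theorem isProbabilityMeasure_inverseWishart (hqp : q ≤ p) {T : Matrix (Fin q) (Fin q) ℝ}
    (hT : T.PosDef) : IsProbabilityMeasure (inverseWishart (p : ℝ) T) := by
  have hT0 := hT.det_pos
  have hG := multiGamma_pos (lgamma_half_ne_top hqp)
  constructor
  rw [← lintegral_one, lintegral_inverseWishart T (h := fun _ => 1) measurable_const]
  have h1 : ∫⁻ S, ENNReal.ofReal (invWishartDensity p T S) * 1 ∂(muP q) =
      ∫⁻ S, ENNReal.ofReal (T.det ^ ((p : ℝ) / 2) * ((2 : ℝ) ^ ((p : ℝ) * q / 2) *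
        multiGamma q ((p : ℝ) / 2))⁻¹) * ENNReal.ofReal
        (Real.exp (-(T * S⁻¹).trace / 2) * (S⁻¹).det ^ ((p : ℝ) / 2)) ∂(muP q) := by
    refine lintegral_congr_ae ?_
    filter_upwards [ae_posDef_muP q] with S hS
    rw [mul_one, ← ENNReal.ofReal_mul (by positivity)]
    congr 1
    rw [invWishartDensity, det_nonsing_inv, Ring.inverse_eq_inv', Real.inv_rpow hS.det_pos.le]
    have := Real.rpow_pos_of_pos hS.det_pos ((p : ℝ) / 2)
    field_simp
  rw [h1, lintegral_const_mul' _ _ ENNReal.ofReal_ne_top,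
    lintegral_muP_inv (g := fun S : Matrix (Fin q) (Fin q) ℝ => ENNReal.ofReal
      (Real.exp (-(T * S).trace / 2) * S.det ^ ((p : ℝ) / 2))) (by fun_prop),
    lintegral_exp_neg_trace_mul _ hT, ← ofReal_multiGamma (lgamma_half_ne_top hqp),
    ← ENNReal.ofReal_mul (by positivity), ← ENNReal.ofReal_mul (by positivity),
    ← ENNReal.ofReal_one]
  congr 1
  rw [Real.rpow_neg hT0.le, show (p : ℝ) / 2 * q = p * q / 2 by ring]
  have := Real.rpow_pos_of_pos hT0 ((p : ℝ) / 2)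
  field_simp

theorem isProbabilityMeasure_proposal (hqp : q ≤ p) (ρ : ℝ) {U : Matrix (Fin p) (Fin p) ℝ}
    (hU : U.PosDef) {x : Matrix (Fin p) (Fin q) ℝ} (hx : (xᵀ * U⁻¹ * x).det ≠ 0) :
    IsProbabilityMeasure (proposal ρ U x) := by
  have hS := posDef_transpose_mul_mul hU.inv hx
  have := isProbabilityMeasure_inverseWishart hqp hS
  have hb : IsProbabilityMeasure ((inverseWishart (p : ℝ) (xᵀ * U⁻¹ * x)).bind fun V =>
      (matrixNormal 0 U V : Measure (Matrix (Fin p) (Fin q) ℝ))) := by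
    constructor
    rw [Measure.bind_apply MeasurableSet.univ (measurable_matrixNormal U).aemeasurable,
      lintegral_congr_ae (g := fun _ => 1)]
    · simp
    · have : ∀ᵐ V ∂(inverseWishart (p : ℝ) (xᵀ * U⁻¹ * x)), V.PosDef :=
        (withDensity_absolutelyContinuous _ _).ae_le (ae_posDef_muP q)
      filter_upwards [this] with V hV
      have := isProbabilityMeasure_matrixNormal hU hV
      exact measure_univ
  exact Measure.isProbabilityMeasure_map (Measurable.aemeasurable (by fun_prop))

/-- The two exponents add up to a single trace against `V⁻¹`, and the two determinant factors to
`det V ^ (-p)`. After `V ↦ V⁻¹` this is a Gamma integral with parameter `p`. -/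
theorem lintegral_invWishartDensity_mul (hqp : q ≤ p) {U : Matrix (Fin p) (Fin p) ℝ}
    (hU : U.PosDef) {S : Matrix (Fin q) (Fin q) ℝ} (hS : S.PosDef)
    (w : Matrix (Fin p) (Fin q) ℝ) :
    ∫⁻ V, ENNReal.ofReal (invWishartDensity p S V) * ENNReal.ofReal (normalDensity U V w)
        ∂(muP q) =
      ENNReal.ofReal (S.det ^ ((p : ℝ) / 2) * multiGamma q p /
        (multiGamma q ((p : ℝ) / 2) * Real.pi ^ ((p : ℝ) * q / 2) * U.det ^ ((q : ℝ) / 2)) *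
        ((S + wᵀ * U⁻¹ * w).det ^ p)⁻¹) := by
  have hT : (S + wᵀ * U⁻¹ * w).PosDef := by
    have h := hU.inv.posSemidef.conjTranspose_mul_mul_same w
    rw [conjTranspose_eq_transpose_of_trivial] at h
    exact hS.add_posSemidef h
  set T := S + wᵀ * U⁻¹ * w with hTdef
  have hU0 := hU.det_pos
  have hS0 := hS.det_pos
  have hT0 := hT.det_pos
  have hG := multiGamma_pos (lgamma_half_ne_top hqp)
  have hG' := multiGamma_pos (lgamma_ne_top hqp)
  have h1 : ∫⁻ V, ENNReal.ofReal (invWishartDensity p S V) *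
        ENNReal.ofReal (normalDensity U V w) ∂(muP q) =
      ∫⁻ V, ENNReal.ofReal (S.det ^ ((p : ℝ) / 2) / ((2 : ℝ) ^ ((p : ℝ) * q / 2) *
        multiGamma q ((p : ℝ) / 2) * ((2 * Real.pi) ^ ((p : ℝ) * q / 2) *
        U.det ^ ((q : ℝ) / 2)))) * ENNReal.ofReal
        (Real.exp (-(T * V⁻¹).trace / 2) * (V⁻¹).det ^ (p : ℝ)) ∂(muP q) := by
    refine lintegral_congr_ae ?_
    filter_upwards [ae_posDef_muP q] with V hV
    have hV0 := hV.det_pos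
    have htr : (T * V⁻¹).trace = (S * V⁻¹).trace + (V⁻¹ * wᵀ * U⁻¹ * w).trace := by
      rw [hTdef, Matrix.add_mul, trace_add, trace_mul_comm (wᵀ * U⁻¹ * w)]
      simp only [Matrix.mul_assoc]
    rw [← ENNReal.ofReal_mul (by unfold invWishartDensity; positivity),
      ← ENNReal.ofReal_mul (by positivity)]
    congr 1
    have hVp : V.det ^ (p : ℝ) = V.det ^ ((p : ℝ) / 2) * V.det ^ ((p : ℝ) / 2) := by
      rw [← Real.rpow_add hV0]; congr 1; ring
    rw [invWishartDensity, normalDensity, htr, neg_add, add_div, Real.exp_add, det_nonsing_inv,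
      Ring.inverse_eq_inv', Real.inv_rpow hV0.le, hVp]
    have := Real.rpow_pos_of_pos hV0 ((p : ℝ) / 2)
    field_simp
  rw [h1, lintegral_const_mul' _ _ ENNReal.ofReal_ne_top,
    lintegral_muP_inv (g := fun V : Matrix (Fin q) (Fin q) ℝ => ENNReal.ofReal
      (Real.exp (-(T * V).trace / 2) * V.det ^ (p : ℝ))) (by fun_prop),
    lintegral_exp_neg_trace_mul _ hT, ← ofReal_multiGamma (lgamma_ne_top hqp),
    ← ENNReal.ofReal_mul (by positivity), ← ENNReal.ofReal_mul (by positivity)]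
  congr 1
  have h2 : (2 : ℝ) ^ ((p : ℝ) * q) = 2 ^ ((p : ℝ) * q / 2) * 2 ^ ((p : ℝ) * q / 2) := by
    rw [← Real.rpow_add zero_lt_two]; congr 1; ring
  rw [h2, Real.rpow_neg hT0.le, Real.rpow_natCast, Real.mul_rpow zero_le_two Real.pi_pos.le]
  field_simp

theorem lintegral_bind_matrixNormal (hqp : q ≤ p) {U : Matrix (Fin p) (Fin p) ℝ}
    (hU : U.PosDef) {S : Matrix (Fin q) (Fin q) ℝ} (hS : S.PosDef)
    {h : Matrix (Fin p) (Fin q) ℝ → ℝ≥0∞} (hh : Measurable h) :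
    ∫⁻ w, h w ∂((inverseWishart (p : ℝ) S).bind fun V => matrixNormal 0 U V) =
      ENNReal.ofReal (S.det ^ ((p : ℝ) / 2) * multiGamma q p /
        (multiGamma q ((p : ℝ) / 2) * Real.pi ^ ((p : ℝ) * q / 2) * U.det ^ ((q : ℝ) / 2))) *
      ∫⁻ w, ENNReal.ofReal ((S + wᵀ * U⁻¹ * w).det ^ p)⁻¹ * h w ∂(lebM p q) := by
  have hG := multiGamma_pos (lgamma_half_ne_top hqp)
  have hG' := multiGamma_pos (lgamma_ne_top hqp)
  have hU0 := hU.det_pos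
  have hS0 := hS.det_pos
  have hm : Measurable fun V : Matrix (Fin q) (Fin q) ℝ => ∫⁻ w, h w ∂(matrixNormal 0 U V) :=
    (Measure.measurable_lintegral hh).comp (measurable_matrixNormal U)
  rw [Measure.lintegral_bind (measurable_matrixNormal U).aemeasurable hh.aemeasurable,
    lintegral_inverseWishart S hm, ← lintegral_const_mul' _ _ ENNReal.ofReal_ne_top]
  simp only [lintegral_matrixNormal U _ hh]
  calc ∫⁻ V, ENNReal.ofReal (invWishartDensity p S V) *
        ∫⁻ w, ENNReal.ofReal (normalDensity U V w) * h w ∂(lebM p q) ∂(muP q)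
      = ∫⁻ V, ∫⁻ w, ENNReal.ofReal (invWishartDensity p S V) *
          (ENNReal.ofReal (normalDensity U V w) * h w) ∂(lebM p q) ∂(muP q) := by
        refine lintegral_congr fun V => ?_
        rw [lintegral_const_mul' _ _ ENNReal.ofReal_ne_top]
    _ = ∫⁻ w, ∫⁻ V, ENNReal.ofReal (invWishartDensity p S V) *
          (ENNReal.ofReal (normalDensity U V w) * h w) ∂(muP q) ∂(lebM p q) :=
        lintegral_lintegral_swap (by unfold Function.uncurry; fun_prop)
    _ = _ := by
        refine lintegral_congr fun w => ?_
        simp only [← mul_assoc]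
        rw [lintegral_mul_const _ (by fun_prop),
          lintegral_invWishartDensity_mul hqp hU hS, ENNReal.ofReal_mul (by positivity)]

end Proposal

/-! ### The law of the multiplicative noise -/

section Noise

variable {p q : ℕ}

/-- The Gram matrix `1 + zᵀz - √ρ (zᵀE + Eᵀz)`, where `E` is the first `q` columns of `1`. -/
noncomputable def shiftedGram (hqp : q ≤ p) (ρ : ℝ) (z : Matrix (Fin p) (Fin q) ℝ) :
    Matrix (Fin q) (Fin q) ℝ :=
  1 + zᵀ * z - √ρ • ((firstCols hqp)ᵀ * z + zᵀ * firstCols hqp)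

theorem measurable_shiftedGram_det_pow (hqp : q ≤ p) (ρ : ℝ) :
    Measurable fun z : Matrix (Fin p) (Fin q) ℝ => (shiftedGram hqp ρ z).det ^ p := by
  have : Continuous fun z : Matrix (Fin p) (Fin q) ℝ => (shiftedGram hqp ρ z).det ^ p := by
    unfold shiftedGram
    fun_prop
  exact this.measurable

theorem firstCols_transpose_mul_self (hqp : q ≤ p) :
    (firstCols hqp)ᵀ * firstCols hqp = 1 := by
  rw [transpose_mul_firstCols]
  ext i j
  simp [firstCols, one_apply]

/-- Completing the square: the cross terms cancel, and the constant is `1 + ρ - 2ρ = 1 - ρ` because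
`E` has orthonormal columns. -/
theorem shiftedGram_affine (hqp : q ≤ p) {ρ : ℝ} (hρ0 : 0 ≤ ρ) (hρ1 : ρ < 1)
    (z : Matrix (Fin p) (Fin q) ℝ) :
    shiftedGram hqp ρ (√ρ • firstCols hqp + √(1 - ρ) • z) = (1 - ρ) • (1 + zᵀ * z) := by
  have h1 : √ρ * √ρ = ρ := Real.mul_self_sqrt hρ0
  have h2 : √(1 - ρ) * √(1 - ρ) = 1 - ρ := Real.mul_self_sqrt (by linarith)
  have hE := firstCols_transpose_mul_self hqp
  simp only [shiftedGram, transpose_add, transpose_smul, Matrix.add_mul, Matrix.mul_add,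
    Matrix.smul_mul, Matrix.mul_smul, smul_smul, hE, h1, h2, smul_add]
  match_scalars <;> linarith

theorem lintegral_lebM_affine {a : ℝ} (ha : 0 < a) (E : Matrix (Fin p) (Fin q) ℝ)
    {h : Matrix (Fin p) (Fin q) ℝ → ℝ≥0∞} (hh : Measurable h) :
    ENNReal.ofReal (a ^ (q * p)) * ∫⁻ z, h (E + a • z) ∂(lebM p q) = ∫⁻ z, h z ∂(lebM p q) := by
  have h1 : ∫⁻ z, h (E + z) ∂(lebM p q) = ∫⁻ z, h z ∂(lebM p q) :=
    lintegral_add_left_eq_self (μ := (volume : Measure (Fin p → Fin q → ℝ))) h E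
  have h2 := lintegral_lebM_mul (p := p) (B := 1) (D := a • (1 : Matrix (Fin q) (Fin q) ℝ))
    (by simp) (by simp [ha.ne']) (h := fun z => h (E + z)) (by fun_prop)
  simpa [det_smul, h1, ← pow_mul, abs_of_pos ha] using h2

theorem lintegral_proposal (hqp : q ≤ p) {ρ : ℝ} (hρ0 : 0 ≤ ρ) (hρ1 : ρ < 1)
    {U : Matrix (Fin p) (Fin p) ℝ} (hU : U.PosDef) {x : Matrix (Fin p) (Fin q) ℝ}
    (hx : (xᵀ * U⁻¹ * x).det ≠ 0) :
    ∃ B : Matrix (Fin p) (Fin p) ℝ, Bᵀ * U⁻¹ * B = 1 ∧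
    ∀ h : Matrix (Fin p) (Fin q) ℝ → ℝ≥0∞, Measurable h →
      ∫⁻ y, h y ∂(proposal ρ U x) =
        ENNReal.ofReal ((1 - ρ) ^ ((p : ℝ) * q / 2) * multiGamma q p /
          (multiGamma q ((p : ℝ) / 2) * Real.pi ^ ((p : ℝ) * q / 2))) *
        ∫⁻ z, ENNReal.ofReal ((shiftedGram hqp ρ z).det ^ p)⁻¹ *
          h (B * z * psqrt (xᵀ * U⁻¹ * x)) ∂(lebM p q) := by
  have hS := posDef_transpose_mul_mul hU.inv hx
  set S := xᵀ * U⁻¹ * x with hSdef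
  set D := psqrt S with hD
  have hDt : Dᵀ = D := psqrt_transpose hS
  have hDi : (D⁻¹)ᵀ = D⁻¹ := by rw [transpose_nonsing_inv, hDt]
  have hUi : ((psqrt U)⁻¹)ᵀ = (psqrt U)⁻¹ := by rw [transpose_nonsing_inv, psqrt_transpose hU]
  have hUinv : U⁻¹ = (psqrt U)⁻¹ * (psqrt U)⁻¹ := by
    rw [← Matrix.mul_inv_rev, psqrt_mul_self hU]
  -- The columns of `U^{-1/2} x S^{-1/2}` are orthonormal by the definition of `S`; `B = U^{1/2} R`
  -- then carries `E` to `x S^{-1/2}`.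
  obtain ⟨R, hR⟩ := exists_mul_firstCols_eq hqp (O := (psqrt U)⁻¹ * x * D⁻¹) (by
    have : ((psqrt U)⁻¹ * x * D⁻¹)ᵀ * ((psqrt U)⁻¹ * x * D⁻¹) = D⁻¹ * S * D⁻¹ := by
      rw [hSdef, hUinv, transpose_mul, transpose_mul, hDi, hUi]
      simp only [Matrix.mul_assoc]
    rw [this, ← psqrt_mul_self hS, ← hD, ← Matrix.mul_assoc, psqrt_inv_mul hS, Matrix.one_mul,
      psqrt_mul_inv hS])
  have hRR : (R.1)ᵀ * R.1 = 1 := by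
    have := mem_unitaryGroup_iff'.mp R.2
    rwa [star_eq_conjTranspose, conjTranspose_eq_transpose_of_trivial] at this
  have hB : (psqrt U * R.1)ᵀ * U⁻¹ * (psqrt U * R.1) = 1 := by
    have h : (psqrt U * R.1)ᵀ * U⁻¹ * (psqrt U * R.1) =
        (R.1)ᵀ * ((psqrt U * (psqrt U)⁻¹) * ((psqrt U)⁻¹ * psqrt U)) * R.1 := by
      rw [transpose_mul, psqrt_transpose hU, hUinv]
      simp only [Matrix.mul_assoc]
    rw [h, psqrt_mul_inv hU, psqrt_inv_mul hU, Matrix.mul_one, Matrix.mul_one, hRR]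
  set B := psqrt U * R.1 with hBdef
  have hx' : x = B * firstCols hqp * D := by
    rw [hBdef, Matrix.mul_assoc (psqrt U), hR, Matrix.mul_assoc (psqrt U), Matrix.mul_assoc (_ * x),
      psqrt_inv_mul hS, Matrix.mul_one, ← Matrix.mul_assoc, psqrt_mul_inv hU, Matrix.one_mul]
  have hBabs : |B.det| ^ q = U.det ^ ((q : ℝ) / 2) := by
    rw [hBdef, det_mul, abs_mul, abs_det_orthogonal, mul_one, abs_of_pos (det_psqrt_pos hU),
      det_psqrt_pow hU]
  have hDabs : |D.det| ^ p = S.det ^ ((p : ℝ) / 2) := by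
    rw [abs_of_pos (det_psqrt_pos hS), det_psqrt_pow hS]
  have hB0 : B.det ≠ 0 := by
    rw [hBdef, det_mul]
    refine mul_ne_zero (det_psqrt_pos hU).ne' fun h0 => ?_
    have := abs_det_orthogonal R
    simp [h0] at this
  have hU0 := hU.det_pos
  have hS0 := hS.det_pos
  have hG := multiGamma_pos (lgamma_half_ne_top hqp)
  have hG' := multiGamma_pos (lgamma_ne_top hqp)
  have hρ : 0 < 1 - ρ := by linarith
  refine ⟨B, hB, fun h hh => ?_⟩
  have hk := measurable_shiftedGram_det_pow hqp ρ
  -- Substituting `w = B z D` on the left and the affine map `z ↦ √ρ E + √(1-ρ) z` on the right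
  -- makes the integrands agree pointwise.
  rw [proposal, lintegral_map hh (by fun_prop), lintegral_bind_matrixNormal hqp hU hS
      (h := fun w => h (√ρ • x + √(1 - ρ) • w)) (by fun_prop),
    ← lintegral_lebM_mul hB0 (det_psqrt_pos hS).ne' (by fun_prop),
    ← lintegral_lebM_affine (Real.sqrt_pos.mpr hρ) (√ρ • firstCols hqp)
      (h := fun z => ENNReal.ofReal ((shiftedGram hqp ρ z).det ^ p)⁻¹ * h (B * z * D))
      (by fun_prop),
    ← hD, hBabs, hDabs, ← mul_assoc, ← mul_assoc, ← ENNReal.ofReal_mul (by positivity),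
    ← ENNReal.ofReal_mul (by positivity), ← lintegral_const_mul' _ _ ENNReal.ofReal_ne_top,
    ← lintegral_const_mul' _ _ ENNReal.ofReal_ne_top]
  refine lintegral_congr fun z => ?_
  have hz : (1 + zᵀ * z).PosDef := by
    have h := posSemidef_conjTranspose_mul_self z
    rw [conjTranspose_eq_transpose_of_trivial] at h
    exact PosDef.one.add_posSemidef h
  have h1 : S + (B * z * D)ᵀ * U⁻¹ * (B * z * D) = D * (1 + zᵀ * z) * D := by
    have h : (B * z * D)ᵀ * U⁻¹ * (B * z * D) = D * (zᵀ * (Bᵀ * U⁻¹ * B) * z) * D := by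
      rw [transpose_mul, transpose_mul, hDt]
      simp only [Matrix.mul_assoc]
    rw [h, hB, Matrix.mul_one, Matrix.mul_add, Matrix.add_mul, Matrix.mul_one, psqrt_mul_self hS]
  have h2 : √ρ • x + √(1 - ρ) • (B * z * D) =
      B * (√ρ • firstCols hqp + √(1 - ρ) • z) * D := by
    conv_lhs => rw [hx']
    simp only [Matrix.mul_add, Matrix.add_mul, Matrix.mul_smul, Matrix.smul_mul]
  have hz0 := hz.det_pos
  rw [h1, h2, shiftedGram_affine hqp hρ0 hρ1, ← mul_assoc (ENNReal.ofReal _),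
    ← mul_assoc (ENNReal.ofReal _),
    ← ENNReal.ofReal_mul (by positivity), ← ENNReal.ofReal_mul (by positivity)]
  congr 2
  have h3 : (D * (1 + zᵀ * z) * D).det = S.det * (1 + zᵀ * z).det := by
    rw [det_mul, det_mul, ← det_psqrt_sq hS]
    ring
  have h4 : √(1 - ρ) ^ (q * p) = (1 - ρ) ^ ((p : ℝ) * q / 2) := by
    rw [Real.sqrt_eq_rpow, ← Real.rpow_natCast, ← Real.rpow_mul hρ.le]
    congr 1; push_cast; ring
  have h5 : ((1 - ρ) ^ q) ^ p = (1 - ρ) ^ ((p : ℝ) * q / 2) * (1 - ρ) ^ ((p : ℝ) * q / 2) := by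
    rw [← Real.rpow_add hρ, ← pow_mul, ← Real.rpow_natCast]
    congr 1; push_cast; ring
  have h6 : S.det ^ p = S.det ^ ((p : ℝ) / 2) * S.det ^ ((p : ℝ) / 2) := by
    rw [← Real.rpow_add hS0, ← Real.rpow_natCast]
    congr 1; ring
  rw [h3, h4, det_smul, Fintype.card_fin, mul_pow, mul_pow, h5, h6]
  have := Real.rpow_pos_of_pos hρ ((p : ℝ) * q / 2)
  field_simp

/-- The integrand in the definition of the noise law. -/
theorem noise_integrand_eq (hqp : q ≤ p) (ρ : ℝ) {O : Matrix (Fin p) (Fin q) ℝ}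
    (hO : Oᵀ * O = 1) {S : Matrix (Fin q) (Fin q) ℝ} (hS : S.PosDef) :
    1 + S - √ρ • (O.submatrix (Fin.castLE hqp) id * psqrt S +
      psqrt S * (O.submatrix (Fin.castLE hqp) id)ᵀ) = shiftedGram hqp ρ (O * psqrt S) := by
  have h1 : (O * psqrt S)ᵀ * (O * psqrt S) = S := by
    rw [transpose_mul, psqrt_transpose hS, Matrix.mul_assoc, ← Matrix.mul_assoc Oᵀ, hO,
      Matrix.one_mul, psqrt_mul_self hS]
  rw [shiftedGram, h1, ← transpose_mul_firstCols, transpose_mul O, transpose_mul _ O,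
    transpose_transpose, psqrt_transpose hS, Matrix.mul_assoc, Matrix.mul_assoc]

theorem ae_uniformStiefel (hqp : q ≤ p) : ∀ᵐ O ∂(uniformStiefel hqp), Oᵀ * O = 1 := by
  rw [uniformStiefel, ae_map_iff (Measurable.aemeasurable (by fun_prop))
    (isClosed_eq (by fun_prop) (by fun_prop)).measurableSet]
  refine Filter.Eventually.of_forall fun R => ?_
  have := mem_unitaryGroup_iff'.mp R.2
  rw [star_eq_conjTranspose, conjTranspose_eq_transpose_of_trivial] at this
  rw [← mul_firstCols, transpose_mul, Matrix.mul_assoc, ← Matrix.mul_assoc (R.1)ᵀ, this,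
    Matrix.one_mul, firstCols_transpose_mul_self]

/-- The integrand of the noise density. -/
noncomputable def noiseIntegrand (hqp : q ≤ p) (ρ : ℝ) (S : Matrix (Fin q) (Fin q) ℝ)
    (O : Matrix (Fin p) (Fin q) ℝ) : ℝ :=
  S.det ^ ((p : ℝ) / 2) / (1 + S - √ρ • (O.submatrix (Fin.castLE hqp) id * psqrt S +
      psqrt S * (O.submatrix (Fin.castLE hqp) id)ᵀ)).det ^ p

@[fun_prop]
theorem measurable_noiseIntegrand {α : Type*} [MeasurableSpace α] (hqp : q ≤ p) (ρ : ℝ)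
    {f : α → Matrix (Fin q) (Fin q) ℝ} {g : α → Matrix (Fin p) (Fin q) ℝ}
    (hf : Measurable f) (hg : Measurable g) :
    Measurable fun a => noiseIntegrand hqp ρ (f a) (g a) := by
  have h : Measurable fun A : Matrix (Fin q) (Fin q) ℝ × Matrix (Fin q) (Fin q) ℝ =>
      1 + A.1 - √ρ • A.2 := Continuous.measurable (by fun_prop)
  have h' : Measurable fun a => 1 + f a - √ρ • ((g a).submatrix (Fin.castLE hqp) id *
      psqrt (f a) + psqrt (f a) * ((g a).submatrix (Fin.castLE hqp) id)ᵀ) :=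
    h.comp (f := fun a => (f a, (g a).submatrix (Fin.castLE hqp) id * psqrt (f a) +
      psqrt (f a) * ((g a).submatrix (Fin.castLE hqp) id)ᵀ)) (hf.prodMk (by fun_prop))
  unfold noiseIntegrand
  fun_prop

/-- The density of the noise law with respect to `muP`, up to a constant. -/
noncomputable def noiseDensity (hqp : q ≤ p) (ρ : ℝ) (S : Matrix (Fin q) (Fin q) ℝ) : ℝ≥0∞ :=
  ∫⁻ O, ENNReal.ofReal (noiseIntegrand hqp ρ S O) ∂(uniformStiefel hqp)

theorem measurable_noiseDensity (hqp : q ≤ p) (ρ : ℝ) :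
    Measurable (noiseDensity hqp ρ) :=
  Measurable.lintegral_prod_right' (f := fun z : Matrix (Fin q) (Fin q) ℝ ×
    Matrix (Fin p) (Fin q) ℝ => ENNReal.ofReal (noiseIntegrand hqp ρ z.1 z.2)) (by fun_prop)

theorem lintegral_noiseLaw (hqp : q ≤ p) (ρ : ℝ) {g : Matrix (Fin q) (Fin q) ℝ → ℝ≥0∞}
    (hg : Measurable g) :
    ∫⁻ S, g S ∂(noiseLaw hqp ρ) =
      ENNReal.ofReal ((1 - ρ) ^ ((p : ℝ) * q / 2) * constC p q) *
        ∫⁻ S, noiseDensity hqp ρ S * g S ∂(muP q) := by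
  have hm := measurable_noiseDensity hqp ρ
  have h : noiseLaw hqp ρ = (muP q).withDensity fun S =>
      ENNReal.ofReal ((1 - ρ) ^ ((p : ℝ) * q / 2) * constC p q) * noiseDensity hqp ρ S := rfl
  rw [h, lintegral_withDensity_eq_lintegral_mul _ (by fun_prop) hg,
    ← lintegral_const_mul' _ _ ENNReal.ofReal_ne_top]
  simp only [Pi.mul_apply, mul_assoc]

/-- Replacing `R` by `R⁻¹ = Rᵀ` transposes the top left block. Multiplication by `S^{1/2}` on both
sides then matches the two matrices and contributes `det S` to the determinant, which accounts for
the change in the numerator. -/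
theorem noiseDensity_inv (hqp : q ≤ p) (ρ : ℝ) {S : Matrix (Fin q) (Fin q) ℝ} (hS : S.PosDef) :
    noiseDensity hqp ρ S⁻¹ = noiseDensity hqp ρ S := by
  have hS0 := hS.det_pos
  have hSi : psqrt S⁻¹ = (psqrt S)⁻¹ := psqrt_inv hS
  rw [noiseDensity, noiseDensity, lintegral_uniformStiefel hqp (by fun_prop),
    lintegral_uniformStiefel hqp (by fun_prop), ← lintegral_uniformO_inv (by fun_prop)]
  refine lintegral_congr fun R => ?_
  have hRi : (R⁻¹).1 = (R.1)ᵀ := by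
    change star R.1 = _
    rw [star_eq_conjTranspose, conjTranspose_eq_transpose_of_trivial]
  set A := (R.1 * firstCols hqp).submatrix (Fin.castLE hqp) id with hA
  have hA' : ((R⁻¹).1 * firstCols hqp).submatrix (Fin.castLE hqp) id = Aᵀ := by
    rw [hA, hRi, mul_firstCols, mul_firstCols]
    rfl
  congr 1
  rw [noiseIntegrand, noiseIntegrand, hA', hSi, transpose_transpose]
  set s := psqrt S with hs
  have h1 : s * (1 + S⁻¹ - √ρ • (Aᵀ * s⁻¹ + s⁻¹ * A)) * s = 1 + S - √ρ • (A * s + s * Aᵀ) := by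
    have h2 : s * S⁻¹ * s = 1 := by
      rw [← psqrt_mul_self hS, ← hs, Matrix.mul_inv_rev, ← Matrix.mul_assoc, psqrt_mul_inv hS,
        Matrix.one_mul, psqrt_inv_mul hS]
    have h3 : s * s = S := psqrt_mul_self hS
    have h4 : s * (Aᵀ * s⁻¹) * s = s * Aᵀ := by
      rw [Matrix.mul_assoc, Matrix.mul_assoc, psqrt_inv_mul hS, Matrix.mul_one]
    have h5 : s * (s⁻¹ * A) * s = A * s := by
      rw [← Matrix.mul_assoc, psqrt_mul_inv hS, Matrix.one_mul]
    rw [Matrix.mul_sub, Matrix.sub_mul, Matrix.mul_add, Matrix.add_mul, Matrix.mul_one,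
      Matrix.mul_smul, Matrix.smul_mul, Matrix.mul_add, Matrix.add_mul, h2, h3, h4, h5,
      add_comm S, add_comm (s * Aᵀ)]
  have h2 := congrArg det h1
  rw [det_mul, det_mul] at h2
  have h3 := det_psqrt_sq hS
  rw [← hs] at h3
  have h6 : S.det ^ p = S.det ^ ((p : ℝ) / 2) * S.det ^ ((p : ℝ) / 2) := by
    rw [← Real.rpow_add hS0, ← Real.rpow_natCast]
    congr 1; ring
  rw [← h2, show s.det * (1 + S⁻¹ - √ρ • (Aᵀ * s⁻¹ + s⁻¹ * A)).det * s.det =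
    S.det * (1 + S⁻¹ - √ρ • (Aᵀ * s⁻¹ + s⁻¹ * A)).det by rw [← h3]; ring, mul_pow, h6,
    det_nonsing_inv, Ring.inverse_eq_inv', Real.inv_rpow hS0.le]
  have := Real.rpow_pos_of_pos hS0 ((p : ℝ) / 2)
  rw [mul_assoc, div_mul_eq_div_div, div_self this.ne', div_mul_eq_div_div, one_div]

theorem lintegral_noiseLaw_inv (hqp : q ≤ p) (ρ : ℝ) {g : Matrix (Fin q) (Fin q) ℝ → ℝ≥0∞}
    (hg : Measurable g) :
    ∫⁻ S, g S⁻¹ ∂(noiseLaw hqp ρ) = ∫⁻ S, g S ∂(noiseLaw hqp ρ) := by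
  have hm := measurable_noiseDensity hqp ρ
  rw [lintegral_noiseLaw hqp ρ (g := fun S => g S⁻¹) (by fun_prop), lintegral_noiseLaw hqp ρ hg,
    ← lintegral_muP_inv (g := fun S => noiseDensity hqp ρ S * g S) (by fun_prop)]
  congr 1
  refine lintegral_congr_ae ?_
  filter_upwards [ae_posDef_muP q] with S hS
  rw [noiseDensity_inv hqp ρ hS]

theorem map_inv_noiseLaw (hqp : q ≤ p) (ρ : ℝ) :
    (noiseLaw hqp ρ).map (fun S => S⁻¹) = noiseLaw hqp ρ := by
  refine Measure.ext_of_lintegral _ fun g hg => ?_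
  rw [lintegral_map hg (by fun_prop), lintegral_noiseLaw_inv hqp ρ hg]

theorem polar_noiseDensity (hqp : q ≤ p) (ρ : ℝ) {g : Matrix (Fin q) (Fin q) ℝ → ℝ≥0∞}
    (hg : Measurable g) :
    lgamma q ((p : ℝ) / 2) * ∫⁻ z, ENNReal.ofReal ((shiftedGram hqp ρ z).det ^ p)⁻¹ *
        g (zᵀ * z) ∂(lebM p q) =
      ENNReal.ofReal (Real.pi ^ ((p : ℝ) * q / 2)) *
        ∫⁻ S, noiseDensity hqp ρ S * g S ∂(muP q) := by
  have hk := measurable_shiftedGram_det_pow hqp ρ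
  rw [lintegral_polar hqp (by fun_prop)]
  congr 1
  refine lintegral_congr_ae ?_
  filter_upwards [ae_posDef_muP q] with S hS
  rw [noiseDensity, ← lintegral_const_mul' _ _ ENNReal.ofReal_ne_top, ← lintegral_mul_const]
  · refine lintegral_congr_ae ?_
    filter_upwards [ae_uniformStiefel hqp] with O hO
    have h1 : (O * psqrt S)ᵀ * (O * psqrt S) = S := by
      rw [transpose_mul, psqrt_transpose hS, Matrix.mul_assoc, ← Matrix.mul_assoc Oᵀ, hO,
        Matrix.one_mul, psqrt_mul_self hS]
    rw [noiseIntegrand, noise_integrand_eq hqp ρ hO hS, h1, ← mul_assoc,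
      ← ENNReal.ofReal_mul (Real.rpow_nonneg hS.det_pos.le _),
      div_eq_mul_inv (S.det ^ ((p : ℝ) / 2))]
  · fun_prop

/-- The law of the normalised Gram matrix of the proposal. -/
theorem lintegral_proposal_gram (hqp : q ≤ p) {ρ : ℝ} (hρ0 : 0 ≤ ρ) (hρ1 : ρ < 1)
    {U : Matrix (Fin p) (Fin p) ℝ} (hU : U.PosDef) {x : Matrix (Fin p) (Fin q) ℝ}
    (hx : (xᵀ * U⁻¹ * x).det ≠ 0) {g : Matrix (Fin q) (Fin q) ℝ → ℝ≥0∞} (hg : Measurable g) :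
    ∫⁻ y, g ((psqrt (xᵀ * U⁻¹ * x))⁻¹ * (yᵀ * U⁻¹ * y) * (psqrt (xᵀ * U⁻¹ * x))⁻¹)
        ∂(proposal ρ U x) = ∫⁻ S, g S ∂(noiseLaw hqp ρ) := by
  have hS := posDef_transpose_mul_mul hU.inv hx
  obtain ⟨B, hB, h⟩ := lintegral_proposal hqp hρ0 hρ1 hU hx
  set D := psqrt (xᵀ * U⁻¹ * x) with hD
  have hDt : Dᵀ = D := psqrt_transpose hS
  have hz (z : Matrix (Fin p) (Fin q) ℝ) :
      D⁻¹ * ((B * z * D)ᵀ * U⁻¹ * (B * z * D)) * D⁻¹ = zᵀ * z := by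
    have h1 : D⁻¹ * ((B * z * D)ᵀ * U⁻¹ * (B * z * D)) * D⁻¹ =
        (D⁻¹ * D) * (zᵀ * (Bᵀ * U⁻¹ * B) * z) * (D * D⁻¹) := by
      rw [transpose_mul, transpose_mul, hDt]
      simp only [Matrix.mul_assoc]
    rw [h1, hB, psqrt_inv_mul hS, psqrt_mul_inv hS, Matrix.mul_one, Matrix.mul_one,
      Matrix.one_mul]
  have hρ : 0 < 1 - ρ := by linarith
  have hG := multiGamma_pos (lgamma_half_ne_top hqp)
  have hG' := multiGamma_pos (lgamma_ne_top hqp)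
  have hp := polar_noiseDensity hqp ρ hg
  rw [← ofReal_multiGamma (lgamma_half_ne_top hqp)] at hp
  rw [h (fun y => g (D⁻¹ * (yᵀ * U⁻¹ * y) * D⁻¹)) (by fun_prop), lintegral_noiseLaw hqp ρ hg]
  simp only [hz]
  have hc : (1 - ρ) ^ ((p : ℝ) * q / 2) * constC p q =
      (1 - ρ) ^ ((p : ℝ) * q / 2) * multiGamma q p / (multiGamma q ((p : ℝ) / 2) ^ 2 *
        Real.pi ^ ((p : ℝ) * q / 2)) * Real.pi ^ ((p : ℝ) * q / 2) := by
    have := Real.rpow_pos_of_pos Real.pi_pos ((p : ℝ) * q / 2)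
    rw [constC]
    field_simp
  have hc' : (1 - ρ) ^ ((p : ℝ) * q / 2) * multiGamma q p /
      (multiGamma q ((p : ℝ) / 2) * Real.pi ^ ((p : ℝ) * q / 2)) =
      (1 - ρ) ^ ((p : ℝ) * q / 2) * multiGamma q p / (multiGamma q ((p : ℝ) / 2) ^ 2 *
        Real.pi ^ ((p : ℝ) * q / 2)) * multiGamma q ((p : ℝ) / 2) := by
    have := Real.rpow_pos_of_pos Real.pi_pos ((p : ℝ) * q / 2)
    field_simp
  rw [hc, hc', ENNReal.ofReal_mul (by positivity), ENNReal.ofReal_mul (by positivity), mul_assoc,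
    mul_assoc, hp]

/-- The mass is inherited from the proposal at one admissible point, `x = E` and `U = 1`. -/
theorem isProbabilityMeasure_noiseLaw (hqp : q ≤ p) {ρ : ℝ} (hρ0 : 0 ≤ ρ) (hρ1 : ρ < 1) :
    IsProbabilityMeasure (noiseLaw hqp ρ) := by
  have hx : ((firstCols hqp)ᵀ * (1 : Matrix (Fin p) (Fin p) ℝ)⁻¹ * firstCols hqp).det ≠ 0 := by
    rw [inv_one, Matrix.mul_one, firstCols_transpose_mul_self, det_one]
    exact one_ne_zero
  have := isProbabilityMeasure_proposal hqp ρ PosDef.one hx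
  have h := lintegral_proposal_gram hqp hρ0 hρ1 PosDef.one hx (g := fun _ => 1) measurable_const
  constructor
  rw [← lintegral_one, ← h, lintegral_one, measure_univ]

theorem ae_posDef_noiseLaw (hqp : q ≤ p) (ρ : ℝ) : ∀ᵐ S ∂(noiseLaw hqp ρ), S.PosDef :=
  (withDensity_absolutelyContinuous _ _).ae_le (ae_posDef_muP q)

end Noise

end MpCN

/-! ### Realising the noise on the given probability space -/

theorem mainTheorem3 (p q : ℕ) (hq : 1 ≤ q) (hqp : q ≤ p) (ρ : ℝ) (hρ0 : 0 ≤ ρ) (hρ1 : ρ < 1) :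
    IsProbabilityMeasure (MpCN.noiseLaw hqp ρ) ∧
    (MpCN.noiseLaw hqp ρ).map (fun ε => ε⁻¹) = MpCN.noiseLaw hqp ρ ∧
    ∀ (U : Matrix (Fin p) (Fin p) ℝ) (x : Matrix (Fin p) (Fin q) ℝ),
      U.PosDef → (xᵀ * U⁻¹ * x).det ≠ 0 →
      IsProbabilityMeasure (MpCN.proposal ρ U x) ∧
      ∀ {Ω : Type*} [MeasurableSpace Ω] (P : Measure Ω) [IsProbabilityMeasure P]
        (y : Ω → Matrix (Fin p) (Fin q) ℝ), HasLaw y (MpCN.proposal ρ U x) P →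
        ∃ ε : Ω → Matrix (Fin q) (Fin q) ℝ,
          Measurable ε ∧ (∀ ω, (ε ω).PosDef) ∧
          (∀ᵐ ω ∂P, (y ω)ᵀ * U⁻¹ * y ω = MpCN.circ (ε ω) (xᵀ * U⁻¹ * x)) ∧
          HasLaw ε (MpCN.noiseLaw hqp ρ) P ∧
          IdentDistrib ε (fun ω => (ε ω)⁻¹) P P := by
  refine ⟨MpCN.isProbabilityMeasure_noiseLaw hqp hρ0 hρ1, MpCN.map_inv_noiseLaw hqp ρ,
    fun U x hU hx => ⟨MpCN.isProbabilityMeasure_proposal hqp ρ hU hx, ?_⟩⟩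
  intro Ω _ P _ y hy
  classical
  have hS := MpCN.posDef_transpose_mul_mul hU.inv hx
  set D := MpCN.psqrt (xᵀ * U⁻¹ * x) with hD
  -- Solving `yᵀ U⁻¹ y = ε ∘ S` for `ε` forces this choice.
  set G : Matrix (Fin p) (Fin q) ℝ → Matrix (Fin q) (Fin q) ℝ :=
    fun y => D⁻¹ * (yᵀ * U⁻¹ * y) * D⁻¹ with hG
  have hGm : Measurable G := by fun_prop
  have hym := hy.aemeasurable
  have hGy : AEMeasurable (fun ω => G (y ω)) P := hGm.comp_aemeasurable hym
  have hmap : P.map (fun ω => G (y ω)) = MpCN.noiseLaw hqp ρ := by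
    refine Measure.ext_of_lintegral _ fun g hg => ?_
    rw [lintegral_map' hg.aemeasurable hGy,
      ← MpCN.lintegral_proposal_gram hqp hρ0 hρ1 hU hx hg, ← hy.map_eq,
      lintegral_map' (by fun_prop) hym]
  -- The noise must be measurable and positive definite everywhere, while `y` is only almost
  -- everywhere measurable and `G y` only almost surely definite. A measurable version of `y` and
  -- the default value `1` repair this on a null set.
  set F : Matrix (Fin q) (Fin q) ℝ → Matrix (Fin q) (Fin q) ℝ :=
    fun S => if S.PosDef then S else 1 with hF
  have hFm : Measurable F :=
    Measurable.ite MpCN.measurableSet_posDef measurable_id measurable_const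
  have hpd : ∀ᵐ ω ∂P, (G (y ω)).PosDef := by
    have := MpCN.ae_posDef_noiseLaw hqp ρ
    rw [← hmap, ae_map_iff hGy MpCN.measurableSet_posDef] at this
    exact this
  have hε : ∀ᵐ ω ∂P, F (G (hym.mk y ω)) = G (y ω) := by
    filter_upwards [hpd, hym.ae_eq_mk] with ω h1 h2
    rw [← h2, hF]
    exact if_pos h1
  have hεm : Measurable fun ω => F (G (hym.mk y ω)) := hFm.comp (hGm.comp hym.measurable_mk)
  have hlaw : P.map (fun ω => F (G (hym.mk y ω))) = MpCN.noiseLaw hqp ρ := by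
    rw [← hmap]
    exact Measure.map_congr hε
  refine ⟨fun ω => F (G (hym.mk y ω)), hεm, fun ω => ?_, ?_, ⟨hεm.aemeasurable, hlaw⟩,
    ⟨hεm.aemeasurable, Measurable.aemeasurable (by fun_prop), ?_⟩⟩
  · simp only [hF]
    split_ifs with h
    · exact h
    · exact PosDef.one
  · filter_upwards [hε] with ω h
    rw [h, MpCN.circ, ← hD]
    simp only [hG, ← Matrix.mul_assoc]
    rw [MpCN.psqrt_mul_inv hS, Matrix.one_mul, Matrix.mul_assoc _ D⁻¹ D, MpCN.psqrt_inv_mul hS,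
      Matrix.mul_one]
  · have h := MpCN.map_inv_noiseLaw hqp ρ
    rw [← hlaw, Measure.map_map (by fun_prop) hεm] at h
    exact h.symm
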